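/- For $h>0$ let $P^h=-h^2\frac{d^2}{dx^2}+ix^2$ on $L^2([-1,1];\mathbb{C})$ with Dirichlet conditions, i.e. with domain $\{u\in L^2: u''\in L^2,\ u(-1)=u(1)=0\}$, and let $\lim_h \mathrm{Sp}(P^h)$ be the set of all $E_0\in\mathbb{C}$ for which there are $h_j>0$ with $h_j\to 0$ and $E_j\in \mathrm{Sp}(P^{h_j})$ with $E_j\to E_0$. Let $\Gamma_{-1,1}=\{E\in\mathbb{C}: \mathrm{Re}\,S_{-1,1}(E)=0\}$, where $S_{-1,1}(E)=\int_{-1}^{1}(it^2-E)^{1/2}\,dt$ is taken along the segment $[-1,1]$ with a continuous determination of the square root (if $E\notin i[0,1]$ there are two determinations, which differ by a sign, so the condition does not depend on the choice; for $E\in i[0,1]$ the condition means that it holds for some continuous determination). 1. For large energies the limit spectrum coincides with the curve: there is $R>0$ such that for all $E\in\mathbb{C}$ with $|E|\ge R$, $E\in\lim_h\mathrm{Sp}(P^h)$ if and only if $E\in\Gamma_{-1,1}$. 2. The curve $\Gamma_{-1,1}$ goes to infinity and is asymptotic to the line $\mathbb{R}+\frac{i}{3}$: there are $A,C,R>0$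 and a function $b:\mathbb{R}\to\mathbb{R}$, continuous on $[A,\infty)$, such that for every $a\ge A$ the only real $y$ with $a+iy\in\Gamma_{-1,1}$ is $y=b(a)$, and $|b(a)-\frac13|\le \frac{C}{a}$; moreover every $E\in\Gamma_{-1,1}$ with $|E|\ge R$ satisfies $\mathrm{Re}\,E\ge A$, so that it is one of the points $a+ib(a)$. -/

import Mathlib

open Set Filter Topology MeasureTheory

noncomputable section

namespace LimitSpectrum

/-- Lebesgue measure on the interval `[-1, 1]`. -/
abbrev intervalMeasure : Measure ℝ := volume.restrict (Icc (-1 : ℝ) 1)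

/-- The Hilbert space `L²([-1, 1]; ℂ)`. -/
abbrev L2I : Type := Lp ℂ 2 intervalMeasure

/-- `u ∈ L²`, `u'' = g ∈ L²` and `u (-1) = u 1 = 0`: the class `u` has a representative `U`, with
derivative `U'` on `[-1, 1]`, such that `U'` is absolutely continuous with derivative `g`, and `U`
vanishes at both end points. -/
def HasDirichletSecondDeriv (u g : L2I) : Prop :=
  ∃ U U' : ℝ → ℂ,
    (u : ℝ → ℂ) =ᵐ[intervalMeasure] U ∧
    (∀ x ∈ Icc (-1 : ℝ) 1, HasDerivWithinAt U (U' x) (Icc (-1 : ℝ) 1) x) ∧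
    (∀ x ∈ Icc (-1 : ℝ) 1, U' x = U' (-1) + ∫ t in (-1 : ℝ)..x, g t) ∧
    U (-1) = 0 ∧ U 1 = 0

/-- The graph of the unbounded operator `P^h = -h² d²/dx² + i x²` on `L²([-1, 1])` with domain
`{u ∈ L² : u'' ∈ L², u (-1) = u 1 = 0}`: `u` lies in the domain and `P^h u = f`. -/
def PGraph (h : ℝ) (u f : L2I) : Prop :=
  ∃ g : L2I, HasDirichletSecondDeriv u g ∧
    (f : ℝ → ℂ) =ᵐ[intervalMeasure]
      fun x => -(h : ℂ) ^ 2 * g x + Complex.I * (x : ℂ) ^ 2 * u x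

/-- The spectrum of `P^h`: those `E` for which `P^h - E`, from the domain of `P^h` to `L²`, has no
bounded everywhere defined inverse. -/
def PSpectrum (h : ℝ) : Set ℂ :=
  {E | ¬ ∃ R : L2I →L[ℂ] L2I, ∀ f u : L2I, R f = u ↔ PGraph h u (f + E • u)}

/-- The limit spectrum `lim_h Sp(P^h)`: all limits of `E_j ∈ Sp(P^{h_j})` along some sequence
`h_j > 0` with `h_j → 0`. -/
def limitSpectrum : Set ℂ :=
  {E₀ | ∃ (h : ℕ → ℝ) (E : ℕ → ℂ), (∀ j, 0 < h j) ∧ Tendsto h atTop (𝓝 0) ∧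
    (∀ j, E j ∈ PSpectrum (h j)) ∧ Tendsto E atTop (𝓝 E₀)}

/-- `S` is a value of the action `∫_{-1}^1 (i t² - E)^{1/2} dt`, for a continuous determination of
the square root along `[-1, 1]`. If `E` is not of the form `i t²` with `t ∈ [-1, 1]`, there are
exactly two determinations, and they give opposite values. -/
def IsAction (E S : ℂ) : Prop :=
  ∃ s : ℝ → ℂ, ContinuousOn s (Icc (-1 : ℝ) 1) ∧
    (∀ t ∈ Icc (-1 : ℝ) 1, s t ^ 2 = Complex.I * (t : ℂ) ^ 2 - E) ∧
    S = ∫ t in (-1 : ℝ)..1, s t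

/-- The curve `Γ_{-1,1} = {E : Re S_{-1,1}(E) = 0}`. -/
def Gamma : Set ℂ :=
  {E | ∃ S : ℂ, IsAction E S ∧ S.re = 0}

end LimitSpectrum

end

namespace LimitSpectrum

/-! The spectrum of `P^h` is the zero set of an entire function: `charFun h E` is the value at 1 of
the solution of `P^h u = E u` that starts from -1 with value 0 and slope 1. If it vanishes, this
solution is an eigenfunction. If not, the Green kernel built from `leftSol` and its reflection gives
a bounded inverse (`mem_pSpectrum_iff`).

For `‖E‖ ≥ 100` the quotient `η = i / E` is small, so `i z² - E = -E (1 - η z²)` has no zeros near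
the interval. The action then satisfies `S² = -4 F(E)` with `F = phaseSq`, and `E ∈ Gamma` means
exactly `F(E) ∈ [0, ∞)` (`mem_gamma_iff`). Moreover `F(E) = E - i/3 + O(1/|E|)`, and `F` differs
from the identity by a map of Lipschitz constant 1/4. The graph `b`, its continuity and its
asymptote follow from these two estimates alone.

A Liouville change of variables along a path on which the action grows linearly turns the equation
into `v'' = (R - F(E)/h²) v` on `[-1, 1]` with `|R| ≤ 1` uniformly in `h` (`exists_normal_form`). An
energy identity puts every eigenvalue `F(E)/h²` within bounded distance of `[0, ∞)`, so limits of
eigenvalues satisfy `F ≥ 0`. Conversely, let `F(E₀) = c > 0`. Variation of constants shows that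
`charFun` is `sin (2ω) / ω` to leading order, up to a bounded nonzero factor, where `ω² = F(E)/h²`.
Choosing `h` so that `2ω` is a large multiple of `π` at `E₀` makes `charFun` much smaller at `E₀`
than on a small circle around it, and the maximum principle for `1 / charFun` produces an eigenvalue
near `E₀`. -/

/-! ### Power series solutions of `u'' = (α z² + β) u` -/

/-- Coefficients of the power series `∑ a_m z ^ (2 m + e)`, `e ∈ {0, 1}`, that solves
`u'' = (α z² + β) u`. -/
noncomputable def oscCoeff (e : ℕ) (α β : ℂ) : ℕ → ℂ
  | 0 => 1
  | 1 => β / ((1 + e) * (2 + e))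
  | (m + 2) => (α * oscCoeff e α β m + β * oscCoeff e α β (m + 1)) /
      ((2 * m + 3 + e) * (2 * m + 4 + e))

/-- The recursion gives `1/m! + 1/(m+1)! = (m+2)²/(m+2)!`, and the denominator `(2m+3+e)(2m+4+e)`
absorbs `(m+2)²`. The condition `1 ≤ K` lets both terms be measured by `K ^ (m + 2)`. -/
theorem norm_oscCoeff_le (e : ℕ) {α β : ℂ} {K : ℝ} (hK : 1 ≤ K) (hα : ‖α‖ ≤ K) (hβ : ‖β‖ ≤ K) :
    ∀ m, ‖oscCoeff e α β m‖ ≤ K ^ m / (m.factorial : ℝ)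
  | 0 => by simp [oscCoeff]
  | 1 => by
      have h1 : ‖((1 : ℂ) + e) * (2 + e)‖ = (1 + e) * (2 + e) := by
        rw [show ((1 : ℂ) + e) * (2 + e) = (((1 + e) * (2 + e) : ℝ) : ℂ) by push_cast; ring,
          Complex.norm_real, Real.norm_of_nonneg (by positivity)]
      have h2 : (1 : ℝ) ≤ (1 + e) * (2 + e) := by nlinarith [(Nat.cast_nonneg e : (0 : ℝ) ≤ e)]
      simp only [oscCoeff, norm_div, h1]
      simpa using (div_le_self (norm_nonneg β) h2).trans hβ
  | (m + 2) => by
      have i0 := norm_oscCoeff_le e hK hα hβ m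
      have i1 := norm_oscCoeff_le e hK hα hβ (m + 1)
      have h1 : ‖((2 : ℂ) * m + 3 + e) * (2 * m + 4 + e)‖ = (2 * m + 3 + e) * (2 * m + 4 + e) := by
        rw [show ((2 : ℂ) * m + 3 + e) * (2 * m + 4 + e)
          = (((2 * m + 3 + e) * (2 * m + 4 + e) : ℝ) : ℂ) by push_cast; ring,
          Complex.norm_real, Real.norm_of_nonneg (by positivity)]
      simp only [oscCoeff, norm_div, h1]
      have hm : (0 : ℝ) ≤ m := Nat.cast_nonneg m
      have he : (0 : ℝ) ≤ e := Nat.cast_nonneg e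
      have hK0 : 0 ≤ K := by linarith
      have hf : (0 : ℝ) < m.factorial := by positivity
      have hnum : ‖α * oscCoeff e α β m + β * oscCoeff e α β (m + 1)‖ ≤
          K ^ (m + 2) / m.factorial + K ^ (m + 2) / (m + 1).factorial := by
        refine (norm_add_le _ _).trans (add_le_add ?_ ?_)
        · rw [norm_mul]
          calc ‖α‖ * ‖oscCoeff e α β m‖ ≤ K * (K ^ m / m.factorial) := by gcongr
            _ = K ^ (m + 1) / m.factorial := by ring
            _ ≤ K ^ (m + 2) / m.factorial := by gcongr; omega
        · rw [norm_mul]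
          calc ‖β‖ * ‖oscCoeff e α β (m + 1)‖ ≤ K * (K ^ (m + 1) / (m + 1).factorial) := by gcongr
            _ = K ^ (m + 2) / (m + 1).factorial := by ring
      rw [div_le_iff₀ (by positivity)]
      refine hnum.trans ?_
      have hfac1 : ((m + 1).factorial : ℝ) = (m + 1) * m.factorial := by
        rw [Nat.factorial_succ]; push_cast; ring
      have hfac2 : ((m + 2).factorial : ℝ) = (m + 2) * ((m + 1) * m.factorial) := by
        rw [Nat.factorial_succ, Nat.cast_mul, hfac1]; push_cast; ring
      rw [hfac1, hfac2, show K ^ (m + 2) / (m.factorial : ℝ) + K ^ (m + 2) / ((m + 1) * m.factorial)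
        = K ^ (m + 2) / ((m + 2) * ((m + 1) * m.factorial)) * ((m + 2) * (m + 2)) by field_simp; ring]
      exact mul_le_mul_of_nonneg_left
        (mul_le_mul (by linarith) (by linarith) (by linarith) (by linarith)) (by positivity)

theorem differentiable_oscCoeff (e : ℕ) (α : ℂ) :
    ∀ m, Differentiable ℂ fun β => oscCoeff e α β m
  | 0 => by simp only [oscCoeff]; fun_prop
  | 1 => by simp only [oscCoeff]; fun_prop
  | (m + 2) => by
      have i0 := differentiable_oscCoeff e α m
      have i1 := differentiable_oscCoeff e α (m + 1)
      simp only [oscCoeff]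
      fun_prop

/-- The solution of `u'' = (α z² + β) u` with the parity of `e ∈ {0, 1}`. -/
noncomputable def oscSol (e : ℕ) (α β z : ℂ) : ℂ := ∑' m, oscCoeff e α β m * z ^ (2 * m + e)

theorem norm_oscTerm_le (e : ℕ) {α β z : ℂ} {K ρ : ℝ} (hK : 1 ≤ K) (hα : ‖α‖ ≤ K) (hβ : ‖β‖ ≤ K)
    (hz : ‖z‖ ≤ ρ) (m : ℕ) :
    ‖oscCoeff e α β m * z ^ (2 * m + e)‖ ≤ (K * ρ ^ 2) ^ m / (m.factorial : ℝ) * ρ ^ e := by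
  have hK0 : 0 ≤ K := by linarith
  have hρ : 0 ≤ ρ := (norm_nonneg z).trans hz
  rw [norm_mul, norm_pow]
  calc _ ≤ K ^ m / (m.factorial : ℝ) * ρ ^ (2 * m + e) :=
        mul_le_mul (norm_oscCoeff_le e hK hα hβ m) (by gcongr) (by positivity) (by positivity)
    _ = _ := by rw [pow_add, pow_mul, mul_pow]; ring

theorem summable_oscBound (e : ℕ) (K ρ : ℝ) :
    Summable fun m : ℕ => (K * ρ ^ 2) ^ m / (m.factorial : ℝ) * ρ ^ e :=
  (Real.summable_pow_div_factorial _).mul_right _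

theorem exists_norm_bound (α β : ℂ) : ∃ K : ℝ, 1 ≤ K ∧ ‖α‖ ≤ K ∧ ‖β‖ ≤ K :=
  ⟨1 + ‖α‖ + ‖β‖, by linarith [norm_nonneg α, norm_nonneg β],
    by linarith [norm_nonneg β], by linarith [norm_nonneg α]⟩

theorem hasSum_oscSol (e : ℕ) (α β z : ℂ) :
    HasSum (fun m => oscCoeff e α β m * z ^ (2 * m + e)) (oscSol e α β z) := by
  obtain ⟨K, hK, hα, hβ⟩ := exists_norm_bound α β
  exact (Summable.of_norm_bounded (summable_oscBound e K ‖z‖)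
    fun m => norm_oscTerm_le e hK hα hβ le_rfl m).hasSum

/-- The bound on the terms is uniform for `β` in a disc, so Weierstrass' theorem applies. Holomorphy
in `β` makes `charFun` entire in `E`, which the final maximum principle argument requires. -/
theorem differentiable_oscSol_param (e : ℕ) (α z : ℂ) : Differentiable ℂ fun β => oscSol e α β z := by
  intro β₀
  have h : DifferentiableOn ℂ (fun β => oscSol e α β z) (Metric.ball 0 (‖β₀‖ + 1)) :=
    Complex.differentiableOn_tsum_of_summable_norm
      (u := fun m : ℕ => ((1 + ‖α‖ + (‖β₀‖ + 1)) * ‖z‖ ^ 2) ^ m / (m.factorial : ℝ) * ‖z‖ ^ e)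
      (summable_oscBound e _ _)
      (fun m => ((differentiable_oscCoeff e α m).mul_const _).differentiableOn) Metric.isOpen_ball
      (fun m β hβ => norm_oscTerm_le e (by linarith [norm_nonneg α, norm_nonneg β₀])
        (by linarith [norm_nonneg β₀])
        (by rw [mem_ball_zero_iff] at hβ; linarith [norm_nonneg α]) le_rfl m)
  exact h.differentiableAt (Metric.isOpen_ball.mem_nhds (by simp))

theorem tendstoLocallyUniformlyOn_oscSol (e : ℕ) (α β : ℂ) :
    TendstoLocallyUniformlyOn
      (fun (s : Finset ℕ) z => ∑ m ∈ s, oscCoeff e α β m * z ^ (2 * m + e)) (oscSol e α β)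
      atTop univ := by
  obtain ⟨K, hK, hα, hβ⟩ := exists_norm_bound α β
  rw [tendstoLocallyUniformlyOn_iff_forall_isCompact isOpen_univ]
  intro C _ hC
  obtain ⟨ρ, hρ⟩ := hC.isBounded.exists_norm_le
  exact tendstoUniformlyOn_tsum (summable_oscBound e K ρ)
    fun m z hz => norm_oscTerm_le e hK hα hβ (hρ z hz) m

theorem differentiable_oscSol (e : ℕ) (α β : ℂ) : Differentiable ℂ (oscSol e α β) := by
  rw [← differentiableOn_univ]
  exact (tendstoLocallyUniformlyOn_oscSol e α β).differentiableOn
    (Eventually.of_forall fun s => by fun_prop) isOpen_univ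

theorem deriv_oscSum (e : ℕ) (α β : ℂ) (s : Finset ℕ) :
    deriv (fun z => ∑ m ∈ s, oscCoeff e α β m * z ^ (2 * m + e)) =
      fun z => ∑ m ∈ s, oscCoeff e α β m * ((2 * m + e : ℕ) * z ^ (2 * m + e - 1)) := by
  ext z
  refine HasDerivAt.deriv (HasDerivAt.fun_sum fun m _ => ?_)
  simpa using (hasDerivAt_pow (2 * m + e) z).const_mul (oscCoeff e α β m)

theorem deriv_deriv_oscSum (e : ℕ) (α β : ℂ) (s : Finset ℕ) :
    deriv (fun z => ∑ m ∈ s, oscCoeff e α β m * ((2 * m + e : ℕ) * z ^ (2 * m + e - 1))) =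
      fun z => ∑ m ∈ s, oscCoeff e α β m *
        ((2 * m + e : ℕ) * ((2 * m + e - 1 : ℕ) * z ^ (2 * m + e - 1 - 1))) := by
  ext z
  refine HasDerivAt.deriv (HasDerivAt.fun_sum fun m _ => ?_)
  exact ((hasDerivAt_pow (2 * m + e - 1) z).const_mul _).const_mul _

theorem tendstoLocallyUniformlyOn_deriv_oscSol (e : ℕ) (α β : ℂ) :
    TendstoLocallyUniformlyOn
      (fun (s : Finset ℕ) z => ∑ m ∈ s, oscCoeff e α β m * ((2 * m + e : ℕ) * z ^ (2 * m + e - 1)))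
      (deriv (oscSol e α β)) atTop univ := by
  have := (tendstoLocallyUniformlyOn_oscSol e α β).deriv
    (Eventually.of_forall fun s => by fun_prop) isOpen_univ
  convert this using 2 with s
  exact (deriv_oscSum e α β s).symm

theorem hasSum_deriv_oscSol (e : ℕ) (α β z : ℂ) :
    HasSum (fun m => oscCoeff e α β m * ((2 * m + e : ℕ) * z ^ (2 * m + e - 1)))
      (deriv (oscSol e α β) z) :=
  (tendstoLocallyUniformlyOn_deriv_oscSol e α β).tendsto_at (mem_univ z)

theorem hasSum_deriv_deriv_oscSol (e : ℕ) (α β z : ℂ) :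
    HasSum (fun m => oscCoeff e α β m *
        ((2 * m + e : ℕ) * ((2 * m + e - 1 : ℕ) * z ^ (2 * m + e - 1 - 1))))
      (deriv (deriv (oscSol e α β)) z) := by
  have := ((tendstoLocallyUniformlyOn_deriv_oscSol e α β).deriv
    (Eventually.of_forall fun s => by fun_prop) isOpen_univ).tendsto_at (mem_univ z)
  simp only [Function.comp_def, deriv_deriv_oscSum] at this
  exact this

theorem deriv_deriv_oscSol {e : ℕ} (he : e ≤ 1) (α β z : ℂ) :
    deriv (deriv (oscSol e α β)) z = (α * z ^ 2 + β) * oscSol e α β z := by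
  have h2 := hasSum_deriv_deriv_oscSol e α β z
  have h0 := hasSum_oscSol e α β z
  have h0' := h0
  rw [← hasSum_nat_add_iff' 1] at h0'
  rw [← hasSum_nat_add_iff' 2] at h2
  have key := (h0.mul_left (α * z ^ 2)).add (h0'.mul_left β)
  have hterm : ∀ m : ℕ, oscCoeff e α β (m + 2) * ((2 * (m + 2) + e : ℕ) *
        ((2 * (m + 2) + e - 1 : ℕ) * z ^ (2 * (m + 2) + e - 1 - 1))) =
      α * z ^ 2 * (oscCoeff e α β m * z ^ (2 * m + e)) +
        β * (oscCoeff e α β (m + 1) * z ^ (2 * (m + 1) + e)) := by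
    intro m
    have e1 : 2 * (m + 2) + e - 1 = 2 * m + 3 + e := by omega
    have e2 : 2 * m + 3 + e - 1 = 2 * m + e + 2 := by omega
    have e3 : 2 * (m + 1) + e = 2 * m + e + 2 := by omega
    have n1 : ((2 : ℂ) * m + 3 + e) ≠ 0 := by exact_mod_cast (by omega : 2 * m + 3 + e ≠ 0)
    have n2 : ((2 : ℂ) * m + 4 + e) ≠ 0 := by exact_mod_cast (by omega : 2 * m + 4 + e ≠ 0)
    rw [e1, e2, e3, oscCoeff]
    push_cast
    rw [show (2 : ℂ) * (m + 2) + e = 2 * m + 4 + e by ring]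
    field_simp
    ring
  have h2' := h2.unique (by simpa only [hterm] using key)
  have n1 : ((1 : ℂ) + e) ≠ 0 := by exact_mod_cast (by omega : 1 + e ≠ 0)
  have n2 : ((2 : ℂ) + e) ≠ 0 := by exact_mod_cast (by omega : 2 + e ≠ 0)
  have hs : ∑ m ∈ Finset.range 2, oscCoeff e α β m *
      ((2 * m + e : ℕ) * ((2 * m + e - 1 : ℕ) * z ^ (2 * m + e - 1 - 1))) = β * z ^ e := by
    rw [Finset.sum_range_succ, Finset.sum_range_one]
    -- The lowest term drops out because `e (e - 1) = 0`; only here is `e ≤ 1` essential.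
    have z0 : ((2 * 0 + e : ℕ) : ℂ) * ((2 * 0 + e - 1 : ℕ) : ℂ) = 0 := by
      interval_cases e <;> simp
    have e1 : 2 * 1 + e - 1 = 1 + e := by omega
    have e2 : 1 + e - 1 = e := by omega
    rw [← mul_assoc ((2 * 0 + e : ℕ) : ℂ), z0, e1, e2, show oscCoeff e α β 1 = β / ((1 + e) * (2 + e)) from rfl]
    push_cast
    field_simp
    ring
  rw [hs] at h2'
  simp only [Finset.sum_range_one, oscCoeff, mul_zero, zero_add] at h2'
  linear_combination h2'

theorem oscSol_zero_zero (α β : ℂ) : oscSol 0 α β 0 = 1 := by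
  have h := hasSum_single (f := fun m : ℕ => oscCoeff 0 α β m * 0 ^ (2 * m + 0)) 0
    (fun m hm => by simp [hm])
  exact (hasSum_oscSol 0 α β 0).unique (by simpa [oscCoeff] using h)

theorem oscSol_one_zero (α β : ℂ) : oscSol 1 α β 0 = 0 :=
  (hasSum_oscSol 1 α β 0).unique (by simp)

theorem deriv_oscSol_zero_zero (α β : ℂ) : deriv (oscSol 0 α β) 0 = 0 :=
  (hasSum_deriv_oscSol 0 α β 0).unique (by
    convert hasSum_zero with m
    rcases m with _ | m
    · simp
    · simp [show 2 * (m + 1) - 1 = 2 * m + 1 by omega])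

theorem deriv_oscSol_one_zero (α β : ℂ) : deriv (oscSol 1 α β) 0 = 1 := by
  have h := hasSum_single
    (f := fun m : ℕ => oscCoeff 1 α β m * (((2 * m + 1 : ℕ) : ℂ) * 0 ^ (2 * m + 1 - 1))) 0
    (fun m hm => by simp [hm])
  exact (hasSum_deriv_oscSol 1 α β 0).unique (by simpa [oscCoeff] using h)

theorem hasDerivAt_oscSol (e : ℕ) (α β z : ℂ) :
    HasDerivAt (oscSol e α β) (deriv (oscSol e α β) z) z :=
  (differentiable_oscSol e α β z).hasDerivAt

theorem hasDerivAt_deriv_oscSol {e : ℕ} (he : e ≤ 1) (α β z : ℂ) :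
    HasDerivAt (deriv (oscSol e α β)) ((α * z ^ 2 + β) * oscSol e α β z) z := by
  rw [← deriv_deriv_oscSol he]
  exact ((differentiable_oscSol e α β).deriv z).hasDerivAt

/-- The Wronskian of the even and odd solutions is `1`. -/
theorem oscSol_wronskian (α β z : ℂ) :
    oscSol 0 α β z * deriv (oscSol 1 α β) z - deriv (oscSol 0 α β) z * oscSol 1 α β z = 1 := by
  have hd : ∀ z, HasDerivAt (fun z => oscSol 0 α β z * deriv (oscSol 1 α β) z -
      deriv (oscSol 0 α β) z * oscSol 1 α β z) 0 z := fun z => by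
    refine (((hasDerivAt_oscSol 0 α β z).mul (hasDerivAt_deriv_oscSol le_rfl α β z)).sub
      ((hasDerivAt_deriv_oscSol zero_le_one α β z).mul (hasDerivAt_oscSol 1 α β z))).congr_deriv ?_
    ring
  have := is_const_of_deriv_eq_zero (fun z => (hd z).differentiableAt) (fun z => (hd z).deriv) z 0
  rw [this, oscSol_zero_zero, oscSol_one_zero, deriv_oscSol_zero_zero, deriv_oscSol_one_zero]
  ring

/-- The solution of `u'' = (α z² + β) u` with `u (-1) = 0` and `u' (-1) = 1`. -/
noncomputable def leftSol (α β z : ℂ) : ℂ :=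
  oscSol 0 α β (-1) * oscSol 1 α β z - oscSol 1 α β (-1) * oscSol 0 α β z

/-- The derivative of `leftSol`. -/
noncomputable def leftSolDeriv (α β z : ℂ) : ℂ :=
  oscSol 0 α β (-1) * deriv (oscSol 1 α β) z - oscSol 1 α β (-1) * deriv (oscSol 0 α β) z

theorem hasDerivAt_leftSol (α β z : ℂ) : HasDerivAt (leftSol α β) (leftSolDeriv α β z) z :=
  ((hasDerivAt_oscSol 1 α β z).const_mul _).sub ((hasDerivAt_oscSol 0 α β z).const_mul _)

theorem hasDerivAt_leftSolDeriv (α β z : ℂ) :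
    HasDerivAt (leftSolDeriv α β) ((α * z ^ 2 + β) * leftSol α β z) z := by
  refine (((hasDerivAt_deriv_oscSol le_rfl α β z).const_mul _).sub
    ((hasDerivAt_deriv_oscSol zero_le_one α β z).const_mul _)).congr_deriv ?_
  rw [leftSol]; ring

theorem leftSol_neg_one (α β : ℂ) : leftSol α β (-1) = 0 := by rw [leftSol]; ring

theorem leftSolDeriv_neg_one (α β : ℂ) : leftSolDeriv α β (-1) = 1 := by
  rw [leftSolDeriv]; linear_combination oscSol_wronskian α β (-1)

theorem differentiable_leftSol_param (α z : ℂ) : Differentiable ℂ fun β => leftSol α β z := by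
  have h := fun e w => differentiable_oscSol_param e α w
  exact ((h 0 _).mul (h 1 _)).sub ((h 1 _).mul (h 0 _))

/-! ### Calculus with integrable right-hand sides, and functions in `L²` -/

/-- Increments of the primitive are dominated by those of the primitive of `‖k‖`, whose absolute
continuity is the known real case. -/
theorem absolutelyContinuousOnInterval_integral {k : ℝ → ℂ} (hk : Integrable k) (c a b : ℝ) :
    AbsolutelyContinuousOnInterval (fun x => ∫ t in c..x, k t) a b := by
  have hg : AbsolutelyContinuousOnInterval (fun x => ∫ t in a..x, ‖k t‖) a b :=
    (hk.norm.intervalIntegrable).absolutelyContinuousOnInterval_intervalIntegral (by simp)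
  refine squeeze_zero (fun E => Finset.sum_nonneg fun i _ => dist_nonneg) (fun E => ?_) hg
  refine Finset.sum_le_sum fun i _ => ?_
  rw [dist_comm, dist_eq_norm, intervalIntegral.integral_interval_sub_left
    hk.intervalIntegrable hk.intervalIntegrable, dist_comm, Real.dist_eq,
    intervalIntegral.integral_interval_sub_left hk.norm.intervalIntegrable
    hk.norm.intervalIntegrable]
  exact intervalIntegral.norm_integral_le_abs_integral_norm

/-- Product rule for a `C¹` function and a primitive of an integrable function. -/
theorem mul_integral_eq_integral {a a' k : ℝ → ℂ} (ha : ∀ x, HasDerivAt a (a' x) x)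
    (ha' : Continuous a') (hk : Integrable k) (c x : ℝ) :
    a x * ∫ t in c..x, k t = ∫ t in c..x, (a' t * (∫ s in c..t, k s) + a t * k t) := by
  have hac : Continuous a := continuous_iff_continuousAt.2 fun x => (ha x).continuousAt
  have hK : Continuous fun t => ∫ s in c..t, k s :=
    intervalIntegral.continuous_primitive (fun _ _ => hk.intervalIntegrable) c
  have hint : ∀ p q, IntervalIntegrable (fun t => a' t * (∫ s in c..t, k s) + a t * k t) volume p q :=
    fun p q => ((ha'.mul hK).intervalIntegrable p q).add
      (hk.intervalIntegrable.continuousOn_mul hac.continuousOn)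
  set l := uIcc c x with hl
  -- The integrand is cut off outside the interval to be integrable on all of `ℝ`.
  let k₁ : ℝ → ℂ := indicator l fun t => a' t * (∫ s in c..t, k s) + a t * k t
  have hk₁ : Integrable k₁ := by
    rw [integrable_indicator_iff measurableSet_uIcc]
    exact (intervalIntegrable_iff').1 (hint c x)
  have hCD : ContDiff ℝ 1 a := contDiff_one_iff_deriv.2
    ⟨fun x => (ha x).differentiableAt, by rwa [show deriv a = a' from funext fun x => (ha x).deriv]⟩
  have hAC := (hCD.contDiffOn.absolutelyContinuousOnInterval (a := c) (b := x)).smul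
    (absolutelyContinuousOnInterval_integral hk c c x)
  have hAC2 := hAC.sub (absolutelyContinuousOnInterval_integral hk₁ c c x)
  -- The difference of the two sides is absolutely continuous with derivative 0 almost everywhere,
  -- hence constant; it vanishes at `c`.
  obtain ⟨C, hC⟩ := hAC2.const_of_ae_hasDerivAt_zero (by
    filter_upwards [(hk.intervalIntegrable (a := c) (b := x)).ae_hasDerivAt_integral,
      (hk₁.intervalIntegrable (a := c) (b := x)).ae_hasDerivAt_integral] with t h1 h2 ht
    have d1 := h1 ht c left_mem_uIcc
    have d2 := h2 ht c left_mem_uIcc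
    have := ((ha t).mul d1).sub d2
    refine this.congr_deriv ?_
    simp only [k₁, hl, indicator_of_mem ht, sub_self])
  have e1 := hC c left_mem_uIcc
  have e2 := hC x right_mem_uIcc
  simp only [Pi.sub_apply, smul_eq_mul, Pi.mul_apply, intervalIntegral.integral_same, mul_zero,
    sub_zero] at e1 e2
  rw [← e1, sub_eq_zero] at e2
  rw [e2]
  exact intervalIntegral.integral_congr fun t ht => indicator_of_mem ht _

/-- The representative of a class in `L²([-1, 1])` that vanishes off `[-1, 1]`. -/
noncomputable def extZero (f : L2I) : ℝ → ℂ := indicator (Icc (-1) 1) f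

theorem extZero_ae (f : L2I) : extZero f =ᵐ[intervalMeasure] f :=
  indicator_ae_eq_restrict measurableSet_Icc

theorem memLp_extZero (f : L2I) : MemLp (extZero f) 2 intervalMeasure :=
  (Lp.memLp f).ae_eq (extZero_ae f).symm

theorem integrable_extZero (f : L2I) : Integrable (extZero f) := by
  rw [extZero, integrable_indicator_iff measurableSet_Icc]
  exact (Lp.memLp f).integrable (by norm_num)

theorem extZero_add (f g : L2I) : ∀ᵐ t, extZero (f + g) t = extZero f t + extZero g t := by
  filter_upwards [(ae_restrict_iff' measurableSet_Icc).1 (Lp.coeFn_add f g)] with t ht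
  by_cases hm : t ∈ Icc (-1 : ℝ) 1
  · simpa only [extZero, indicator_of_mem hm, Pi.add_apply] using ht hm
  · simp [extZero, hm]

theorem extZero_smul (c : ℂ) (f : L2I) : ∀ᵐ t, extZero (c • f) t = c * extZero f t := by
  filter_upwards [(ae_restrict_iff' measurableSet_Icc).1 (Lp.coeFn_smul c f)] with t ht
  by_cases hm : t ∈ Icc (-1 : ℝ) 1
  · simp [extZero, hm, ht hm]
  · simp [extZero, hm]

/-- Hölder's inequality: on a set of finite measure the `L¹` norm is controlled by the `L²` norm. -/
theorem exists_integral_norm_extZero_le : ∃ C : ℝ, 0 ≤ C ∧ ∀ f : L2I,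
    ∫ t, ‖extZero f t‖ ≤ C * ‖f‖ := by
  refine ⟨(intervalMeasure univ ^ (1 / (1 : ENNReal).toReal - 1 / (2 : ENNReal).toReal)).toReal,
    ENNReal.toReal_nonneg, fun f => ?_⟩
  have h1 : ∫ t, ‖extZero f t‖ = (eLpNorm f 1 intervalMeasure).toReal := by
    rw [eLpNorm_one_eq_lintegral_enorm, ← integral_norm_eq_lintegral_enorm (Lp.aestronglyMeasurable f),
      ← integral_indicator measurableSet_Icc]
    simp only [extZero, norm_indicator_eq_indicator_norm]
  rw [h1, Lp.norm_def, mul_comm, ← ENNReal.toReal_mul]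
  refine ENNReal.toReal_mono (ENNReal.mul_ne_top (Lp.eLpNorm_ne_top f) ?_)
    (eLpNorm_le_eLpNorm_mul_rpow_measure_univ (by norm_num) (Lp.aestronglyMeasurable f))
  exact ENNReal.rpow_ne_top_of_nonneg (by norm_num) (measure_ne_top _ _)

theorem ae_imp_of_ae_intervalMeasure {p : ℝ → Prop} (h : ∀ᵐ t ∂intervalMeasure, p t) {x : ℝ}
    (hx : x ∈ Icc (-1 : ℝ) 1) : ∀ᵐ t, t ∈ uIoc (-1) x → p t := by
  filter_upwards [(ae_restrict_iff' measurableSet_Icc).1 h] with t ht hm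
  rw [uIoc_of_le hx.1] at hm
  exact ht ⟨hm.1.le, hm.2.trans hx.2⟩

theorem hasDirichletSecondDeriv_toLp {U U' G : ℝ → ℂ} (hU : MemLp U 2 intervalMeasure)
    (hG : MemLp G 2 intervalMeasure)
    (hd : ∀ x ∈ Icc (-1 : ℝ) 1, HasDerivWithinAt U (U' x) (Icc (-1 : ℝ) 1) x)
    (hi : ∀ x ∈ Icc (-1 : ℝ) 1, U' x = U' (-1) + ∫ t in (-1 : ℝ)..x, G t)
    (h0 : U (-1) = 0) (h1 : U 1 = 0) :
    HasDirichletSecondDeriv (hU.toLp U) (hG.toLp G) := by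
  refine ⟨U, U', hU.coeFn_toLp, hd, fun x hx => ?_, h0, h1⟩
  rw [hi x hx]
  congr 1
  exact intervalIntegral.integral_congr_ae
    (ae_imp_of_ae_intervalMeasure (hG.coeFn_toLp.mono fun t ht => ht.symm) hx)

theorem memLp_of_continuous {U : ℝ → ℂ} (hU : Continuous U) : MemLp U 2 intervalMeasure := by
  obtain ⟨C, hC⟩ := isCompact_Icc.exists_bound_of_continuousOn (s := Icc (-1 : ℝ) 1) hU.continuousOn
  exact MemLp.of_bound hU.aestronglyMeasurable C
    ((ae_restrict_iff' measurableSet_Icc).2 (Eventually.of_forall hC))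

theorem intervalIntegrable_coe (g : L2I) {x : ℝ} (hx : x ∈ Icc (-1 : ℝ) 1) :
    IntervalIntegrable g volume (-1) x := by
  have h : IntegrableOn g (Icc (-1 : ℝ) 1) := (Lp.memLp g).integrable (by norm_num)
  rw [intervalIntegrable_iff_integrableOn_Ioc_of_le hx.1]
  exact h.mono_set (Ioc_subset_Icc_self.trans (Icc_subset_Icc_right hx.2))

theorem HasDirichletSecondDeriv.sub {u v g k : L2I} (hu : HasDirichletSecondDeriv u g)
    (hv : HasDirichletSecondDeriv v k) : HasDirichletSecondDeriv (u - v) (g - k) := by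
  obtain ⟨U, U', aU, dU, iU, U0, U1⟩ := hu
  obtain ⟨V, V', aV, dV, iV, V0, V1⟩ := hv
  refine ⟨U - V, U' - V', ?_, fun x hx => (dU x hx).sub (dV x hx), fun x hx => ?_,
    by simp [U0, V0], by simp [U1, V1]⟩
  · exact (Lp.coeFn_sub u v).trans (aU.sub aV)
  · have : ∫ t in (-1 : ℝ)..x, (g - k : L2I) t = ∫ t in (-1 : ℝ)..x, (g t - k t) :=
      intervalIntegral.integral_congr_ae (ae_imp_of_ae_intervalMeasure (Lp.coeFn_sub g k) hx)
    rw [this, intervalIntegral.integral_sub (intervalIntegrable_coe g hx)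
      (intervalIntegrable_coe k hx), Pi.sub_apply, Pi.sub_apply, iU x hx, iV x hx]
    ring

theorem PGraph.sub {h : ℝ} {u v f g : L2I} (hu : PGraph h u f) (hv : PGraph h v g) :
    PGraph h (u - v) (f - g) := by
  obtain ⟨k, hk, ak⟩ := hu
  obtain ⟨l, hl, al⟩ := hv
  refine ⟨k - l, hk.sub hl, ?_⟩
  filter_upwards [ak, al, Lp.coeFn_sub f g, Lp.coeFn_sub u v, Lp.coeFn_sub k l]
    with x h1 h2 h3 h4 h5
  simp only [h3, h4, h5, Pi.sub_apply, h1, h2]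
  ring

/-! ### The spectrum of `P^h` as the zero set of `charFun` -/

/-- The coefficient of `z²` in the equation `u'' = (α z² + β) u` equivalent to `P^h u = E u`. -/
noncomputable def quadCoeff (h : ℝ) : ℂ := Complex.I / (h : ℂ) ^ 2

/-- The constant coefficient in the equation `u'' = (α z² + β) u` equivalent to `P^h u = E u`. -/
noncomputable def constCoeff (h : ℝ) (E : ℂ) : ℂ := -E / (h : ℂ) ^ 2

theorem sq_mul_coeff {h : ℝ} (hh : h ≠ 0) (E z : ℂ) :
    (h : ℂ) ^ 2 * (quadCoeff h * z ^ 2 + constCoeff h E) = Complex.I * z ^ 2 - E := by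
  have hh' : (h : ℂ) ≠ 0 := by exact_mod_cast hh
  rw [quadCoeff, constCoeff]
  field_simp
  ring

/-- The value at `1` of the solution of `P^h u = E u` with `u (-1) = 0`, `u' (-1) = 1`. -/
noncomputable def charFun (h : ℝ) (E : ℂ) : ℂ := leftSol (quadCoeff h) (constCoeff h E) 1

/-- The equation is even, so `z ↦ leftSol α β (-z)` is also a solution, the one that vanishes at 1.
The left side is, up to sign, the Wronskian of the two, hence constant, and is evaluated at `z = 1`.
-/
theorem leftSol_wronskian (α β z : ℂ) :
    leftSol α β z * leftSolDeriv α β (-z) + leftSolDeriv α β z * leftSol α β (-z) =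
      leftSol α β 1 := by
  have hn : ∀ z, HasDerivAt (fun z => leftSol α β (-z)) (-leftSolDeriv α β (-z)) z := fun z => by
    simpa [Function.comp_def] using (hasDerivAt_leftSol α β (-z)).comp z (hasDerivAt_neg z)
  have hn' : ∀ z, HasDerivAt (fun z => leftSolDeriv α β (-z))
      (-((α * z ^ 2 + β) * leftSol α β (-z))) z := fun z => by
    simpa [Function.comp_def] using (hasDerivAt_leftSolDeriv α β (-z)).comp z (hasDerivAt_neg z)
  have hd : ∀ z, HasDerivAt (fun z => leftSol α β z * leftSolDeriv α β (-z) +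
      leftSolDeriv α β z * leftSol α β (-z)) 0 z := fun z => by
    refine (((hasDerivAt_leftSol α β z).mul (hn' z)).add
      ((hasDerivAt_leftSolDeriv α β z).mul (hn z))).congr_deriv ?_
    ring
  have := is_const_of_deriv_eq_zero (fun z => (hd z).differentiableAt) (fun z => (hd z).deriv) z 1
  rw [this, leftSol_neg_one, leftSolDeriv_neg_one]
  ring

/-- `P^h - E` is injective if `charFun h E ≠ 0`. -/
theorem eq_zero_of_pGraph {h : ℝ} (hh : h ≠ 0) {E : ℂ} (hD : charFun h E ≠ 0) {w : L2I}
    (hw : PGraph h w (E • w)) : w = 0 := by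
  obtain ⟨g, ⟨U, U', aU, dU, iU, U0, U1⟩, ag⟩ := hw
  set α := quadCoeff h with hα
  set β := constCoeff h E with hβ
  have hh' : (h : ℂ) ^ 2 ≠ 0 := by exact_mod_cast pow_ne_zero 2 hh
  have hU : ContinuousOn U (Icc (-1 : ℝ) 1) := fun x hx => (dU x hx).continuousWithinAt
  -- A continuous extension of `U` to the line makes the integrand in the formula for `U'`
  -- continuous, so that `U'` is differentiable at every point of the interval.
  let V : ℝ → ℂ := IccExtend (by norm_num : (-1 : ℝ) ≤ 1) ((Icc (-1 : ℝ) 1).domRestrict U)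
  have hV : Continuous V := (continuousOn_iff_continuous_domRestrict.1 hU).Icc_extend'
  have hVU : ∀ x ∈ Icc (-1 : ℝ) 1, V x = U x := fun x hx => by
    simp only [V]; rw [IccExtend_of_mem _ _ hx]; rfl
  have hgV : ∀ᵐ x ∂intervalMeasure, g x = (α * (x : ℂ) ^ 2 + β) * V x := by
    filter_upwards [aU, ag, Lp.coeFn_smul E w, self_mem_ae_restrict measurableSet_Icc]
      with x h1 h2 h3 hx
    rw [h3, Pi.smul_apply, smul_eq_mul, h1] at h2
    rw [hVU x hx]
    refine mul_left_cancel₀ hh' ?_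
    linear_combination h2 - U x * sq_mul_coeff hh E x
  have dU' : ∀ x ∈ Icc (-1 : ℝ) 1,
      HasDerivWithinAt U' ((α * (x : ℂ) ^ 2 + β) * U x) (Icc (-1 : ℝ) 1) x := by
    intro x hx
    have hc : Continuous fun x : ℝ => (α * (x : ℂ) ^ 2 + β) * V x := by fun_prop
    have := ((hc.integral_hasStrictDerivAt (-1) x).hasDerivAt.const_add (U' (-1))).hasDerivWithinAt
      (s := Icc (-1 : ℝ) 1)
    rw [← hVU x hx]
    refine this.congr (fun y hy => ?_) ?_
    · rw [iU y hy, intervalIntegral.integral_congr_ae (ae_imp_of_ae_intervalMeasure hgV hy)]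
    · rw [iU x hx, intervalIntegral.integral_congr_ae (ae_imp_of_ae_intervalMeasure hgV hx)]
  have hφ : ∀ x : ℝ, HasDerivAt (fun x : ℝ => leftSol α β x) (leftSolDeriv α β x) x :=
    fun x => (hasDerivAt_leftSol α β x).comp_ofReal
  have hφ' : ∀ x : ℝ, HasDerivAt (fun x : ℝ => leftSolDeriv α β x)
      ((α * (x : ℂ) ^ 2 + β) * leftSol α β x) x :=
    fun x => (hasDerivAt_leftSolDeriv α β x).comp_ofReal
  have hψ : ∀ x : ℝ, HasDerivAt (fun x : ℝ => leftSol α β (-x)) (-leftSolDeriv α β (-x)) x :=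
    fun x => by
      simpa [Function.comp_def] using
        ((hasDerivAt_leftSol α β (-(x : ℂ))).comp (x : ℂ) (hasDerivAt_neg (x : ℂ))).comp_ofReal
  have hψ' : ∀ x : ℝ, HasDerivAt (fun x : ℝ => leftSolDeriv α β (-x))
      (-((α * (x : ℂ) ^ 2 + β) * leftSol α β (-x))) x := fun x => by
    simpa [Function.comp_def] using
      ((hasDerivAt_leftSolDeriv α β (-(x : ℂ))).comp (x : ℂ) (hasDerivAt_neg (x : ℂ))).comp_ofReal
  have hconst : ∀ W : ℝ → ℂ, (∀ x ∈ Icc (-1 : ℝ) 1, HasDerivWithinAt W 0 (Icc (-1 : ℝ) 1) x) →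
      ∀ x ∈ Icc (-1 : ℝ) 1, W x = W (-1) := fun W hW =>
    constant_of_derivWithin_zero (fun x hx => (hW x hx).differentiableWithinAt) fun x hx =>
      (hW x (Ico_subset_Icc_self hx)).derivWithin
        (uniqueDiffOn_Icc (by norm_num) x (Ico_subset_Icc_self hx))
  -- The Wronskians of `U` with the left and right solutions are constant, and each vanishes at the
  -- end point where both of its factors do. Eliminating `U'` leaves `U x * charFun h E = 0`.
  have hW1 := hconst (fun x => U x * leftSolDeriv α β x - U' x * leftSol α β x) fun x hx => by
    refine (((dU x hx).mul (hφ' x).hasDerivWithinAt).sub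
      ((dU' x hx).mul (hφ x).hasDerivWithinAt)).congr_deriv ?_
    ring
  have hW2 := hconst (fun x => U x * leftSolDeriv α β (-x) + U' x * leftSol α β (-x))
    fun x hx => by
    refine (((dU x hx).mul (hψ' x).hasDerivWithinAt).add
      ((dU' x hx).mul (hψ x).hasDerivWithinAt)).congr_deriv ?_
    ring
  have hone : (1 : ℝ) ∈ Icc (-1 : ℝ) 1 := by norm_num
  have hUz : ∀ x ∈ Icc (-1 : ℝ) 1, U x = 0 := by
    intro x hx
    have e1 := hW1 x hx
    have e2 := (hW2 x hx).trans (hW2 1 hone).symm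
    simp only [Complex.ofReal_neg, Complex.ofReal_one, U0, U1, leftSol_neg_one, zero_mul, mul_zero,
      add_zero, sub_zero] at e1 e2
    have hw := leftSol_wronskian α β x
    have : U x * charFun h E = 0 := by
      rw [charFun, ← hα, ← hβ, ← hw]
      linear_combination leftSol α β (-(x : ℂ)) * e1 + leftSol α β x * e2
    exact (mul_eq_zero.1 this).resolve_right hD
  rw [Lp.eq_zero_iff_ae_eq_zero]
  filter_upwards [aU, self_mem_ae_restrict measurableSet_Icc] with x h1 hx
  rw [h1, hUz x hx]; rfl

/-- A zero of `charFun h` is an eigenvalue of `P^h`. -/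
theorem mem_pSpectrum_of_charFun_eq_zero {h : ℝ} (hh : h ≠ 0) {E : ℂ} (hD : charFun h E = 0) :
    E ∈ PSpectrum h := by
  rintro ⟨R, hR⟩
  set α := quadCoeff h with hα
  set β := constCoeff h E with hβ
  have hh' : (h : ℂ) ^ 2 ≠ 0 := by exact_mod_cast pow_ne_zero 2 hh
  have hφ : ∀ x : ℝ, HasDerivAt (fun x : ℝ => leftSol α β x) (leftSolDeriv α β x) x :=
    fun x => (hasDerivAt_leftSol α β x).comp_ofReal
  have hφ' : ∀ x : ℝ, HasDerivAt (fun x : ℝ => leftSolDeriv α β x)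
      ((α * (x : ℂ) ^ 2 + β) * leftSol α β x) x :=
    fun x => (hasDerivAt_leftSolDeriv α β x).comp_ofReal
  have hc : Continuous fun x : ℝ => leftSol α β x :=
    continuous_iff_continuousAt.2 fun x => (hφ x).continuousAt
  have hc2 : Continuous fun x : ℝ => (α * (x : ℂ) ^ 2 + β) * leftSol α β x := by fun_prop
  have hm := memLp_of_continuous hc
  have hm2 := memLp_of_continuous hc2
  have hdir := hasDirichletSecondDeriv_toLp hm hm2 (fun x _ => (hφ x).hasDerivWithinAt)
    (fun x _ => by
      rw [intervalIntegral.integral_eq_sub_of_hasDerivAt (fun y _ => hφ' y)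
        (hc2.intervalIntegrable _ _)]
      ring) (by simpa using leftSol_neg_one α β) (by simpa [charFun] using hD)
  have hg : PGraph h (hm.toLp _) (0 + E • hm.toLp _) := by
    refine ⟨_, hdir, ?_⟩
    rw [zero_add]
    filter_upwards [Lp.coeFn_smul E (hm.toLp _), hm.coeFn_toLp, hm2.coeFn_toLp] with x h1 h2 h3
    rw [h1, Pi.smul_apply, h2, h3, smul_eq_mul]
    linear_combination leftSol α β x * sq_mul_coeff hh E x
  -- An inverse sends 0 to 0, which would make the eigenfunction vanish, against its slope 1 at -1.
  have h0 := (hR 0 _).2 hg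
  rw [map_zero] at h0
  have hae : (fun x : ℝ => leftSol α β x) =ᵐ[volume.restrict (Icc (-1 : ℝ) 1)] fun _ => 0 := by
    filter_upwards [hm.coeFn_toLp, (Lp.eq_zero_iff_ae_eq_zero).1 h0.symm] with x h1 h2
    rw [← h1, h2]; rfl
  have heq := Measure.eqOn_Icc_of_ae_eq volume (by norm_num) hae hc.continuousOn continuousOn_const
  have hm1 : (-1 : ℝ) ∈ Icc (-1 : ℝ) 1 := by norm_num
  have d1 := (hφ (-1)).hasDerivWithinAt (s := Icc (-1 : ℝ) 1)
  have d2 : HasDerivWithinAt (fun x : ℝ => leftSol α β x) 0 (Icc (-1 : ℝ) 1) (-1) :=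
    (hasDerivWithinAt_const _ _ _).congr heq (heq hm1)
  have := (uniqueDiffOn_Icc (by norm_num : (-1 : ℝ) < 1) _ hm1).eq_deriv _ d1 d2
  simp [leftSolDeriv_neg_one] at this

/-- The solution of `U'' = (α x² + β) U + k`, `U (-1) = U 1 = 0`, multiplied by
`leftSol α β 1`. -/
noncomputable def greenSol (α β : ℂ) (k : ℝ → ℂ) (x : ℝ) : ℂ :=
  leftSol α β x * (∫ t in (1 : ℝ)..x, leftSol α β (-t) * k t) -
    leftSol α β (-x) * (∫ t in (-1 : ℝ)..x, leftSol α β t * k t)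

/-- The derivative of `greenSol`. -/
noncomputable def greenSolDeriv (α β : ℂ) (k : ℝ → ℂ) (x : ℝ) : ℂ :=
  leftSolDeriv α β x * (∫ t in (1 : ℝ)..x, leftSol α β (-t) * k t) +
    leftSolDeriv α β (-x) * (∫ t in (-1 : ℝ)..x, leftSol α β t * k t)

theorem hasDerivAt_leftSol_neg (α β z : ℂ) :
    HasDerivAt (fun z => leftSol α β (-z)) (-leftSolDeriv α β (-z)) z := by
  simpa [Function.comp_def] using (hasDerivAt_leftSol α β (-z)).comp z (hasDerivAt_neg z)

theorem hasDerivAt_leftSolDeriv_neg (α β z : ℂ) :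
    HasDerivAt (fun z => leftSolDeriv α β (-z)) (-((α * z ^ 2 + β) * leftSol α β (-z))) z := by
  simpa [Function.comp_def] using (hasDerivAt_leftSolDeriv α β (-z)).comp z (hasDerivAt_neg z)

theorem continuous_leftSol (α β : ℂ) : Continuous (leftSol α β) :=
  continuous_iff_continuousAt.2 fun z => (hasDerivAt_leftSol α β z).continuousAt

theorem continuous_leftSolDeriv (α β : ℂ) : Continuous (leftSolDeriv α β) :=
  continuous_iff_continuousAt.2 fun z => (hasDerivAt_leftSolDeriv α β z).continuousAt

section Green

variable {α β : ℂ} {k : ℝ → ℂ}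

theorem integrable_leftSol_mul (hk : Integrable k) (hs : ∀ t ∉ Icc (-1 : ℝ) 1, k t = 0) :
    Integrable fun t : ℝ => leftSol α β t * k t := by
  have hc : Continuous fun t : ℝ => leftSol α β t :=
    (continuous_leftSol α β).comp Complex.continuous_ofReal
  have : IntegrableOn (fun t : ℝ => leftSol α β t * k t) (Icc (-1) 1) :=
    hk.integrableOn.continuousOn_mul hc.continuousOn isCompact_Icc
  exact this.integrable_of_forall_notMem_eq_zero fun t ht => by rw [hs t ht, mul_zero]

theorem integrable_leftSol_neg_mul (hk : Integrable k) (hs : ∀ t ∉ Icc (-1 : ℝ) 1, k t = 0) :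
    Integrable fun t : ℝ => leftSol α β (-t) * k t := by
  have hc : Continuous fun t : ℝ => leftSol α β (-t) :=
    (continuous_leftSol α β).comp Complex.continuous_ofReal.neg
  have : IntegrableOn (fun t : ℝ => leftSol α β (-t) * k t) (Icc (-1) 1) :=
    hk.integrableOn.continuousOn_mul hc.continuousOn isCompact_Icc
  exact this.integrable_of_forall_notMem_eq_zero fun t ht => by rw [hs t ht, mul_zero]

theorem continuous_greenSolDeriv (hk : Integrable k) (hs : ∀ t ∉ Icc (-1 : ℝ) 1, k t = 0) :
    Continuous (greenSolDeriv α β k) := by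
  have h1 := intervalIntegral.continuous_primitive
    (fun a b => (integrable_leftSol_mul (α := α) (β := β) hk hs).intervalIntegrable
      (a := a) (b := b)) (-1)
  have h2 := intervalIntegral.continuous_primitive
    (fun a b => (integrable_leftSol_neg_mul (α := α) (β := β) hk hs).intervalIntegrable
      (a := a) (b := b)) 1
  have h3 := continuous_leftSolDeriv α β
  unfold greenSolDeriv
  fun_prop

theorem greenSol_neg_one : greenSol α β k (-1) = 0 := by
  simp [greenSol, leftSol_neg_one]

theorem greenSol_one : greenSol α β k 1 = 0 := by
  simp [greenSol, leftSol_neg_one]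

theorem integral_change_base {q : ℝ → ℂ} (hq : Integrable q) (x : ℝ) :
    ∫ t in (1 : ℝ)..x, q t = (∫ t in (-1 : ℝ)..x, q t) - ∫ t in (-1 : ℝ)..1, q t :=
  (intervalIntegral.integral_interval_sub_left hq.intervalIntegrable hq.intervalIntegrable).symm

/-- As `k` is merely integrable, the derivative is found through the integrated product rule. The
two terms `leftSol(t) leftSol(-t) k(t)` cancel, so the remaining integrand is continuous. -/
theorem greenSol_eq (hk : Integrable k) (hs : ∀ t ∉ Icc (-1 : ℝ) 1, k t = 0) (x : ℝ) :
    greenSol α β k x = ∫ t in (-1 : ℝ)..x, greenSolDeriv α β k t := by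
  have i1 := integrable_leftSol_mul (α := α) (β := β) hk hs
  have i2 := integrable_leftSol_neg_mul (α := α) (β := β) hk hs
  have hd := (continuous_leftSolDeriv α β).comp Complex.continuous_ofReal
  have hd' := (continuous_leftSolDeriv α β).comp Complex.continuous_ofReal.neg
  have hc := (continuous_leftSol α β).comp Complex.continuous_ofReal
  have hc' := (continuous_leftSol α β).comp Complex.continuous_ofReal.neg
  have K1 := intervalIntegral.continuous_primitive
    (fun a b => i1.intervalIntegrable (a := a) (b := b)) (-1)
  have K2 := intervalIntegral.continuous_primitive
    (fun a b => i2.intervalIntegrable (a := a) (b := b)) (-1)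
  have p1 := mul_integral_eq_integral (a := fun x : ℝ => leftSol α β x)
    (fun x => (hasDerivAt_leftSol α β x).comp_ofReal) hd i2 (-1) x
  have p2 := mul_integral_eq_integral (a := fun x : ℝ => leftSol α β (-x))
    (fun x => (hasDerivAt_leftSol_neg α β x).comp_ofReal) hd'.neg i1 (-1) x
  have p3 := intervalIntegral.integral_eq_sub_of_hasDerivAt (a := -1) (b := x)
    (fun x _ => (hasDerivAt_leftSol α β x).comp_ofReal) (hd.intervalIntegrable _ _)
  simp only [Complex.ofReal_neg, Complex.ofReal_one, leftSol_neg_one, sub_zero] at p3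
  have key : (∫ t in (-1 : ℝ)..x, greenSolDeriv α β k t) =
      (∫ t in (-1 : ℝ)..x, (leftSolDeriv α β t * (∫ s in (-1 : ℝ)..t, leftSol α β (-s) * k s) +
        leftSol α β t * (leftSol α β (-t) * k t))) -
      (∫ t in (-1 : ℝ)..x, (-leftSolDeriv α β (-t) * (∫ s in (-1 : ℝ)..t, leftSol α β s * k s) +
        leftSol α β (-t) * (leftSol α β t * k t))) -
      (∫ t in (-1 : ℝ)..x, leftSolDeriv α β t) * ∫ s in (-1 : ℝ)..1, leftSol α β (-s) * k s := by
    rw [← intervalIntegral.integral_mul_const, ← intervalIntegral.integral_sub,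
      ← intervalIntegral.integral_sub]
    · refine intervalIntegral.integral_congr fun t _ => ?_
      simp only [greenSolDeriv]
      rw [integral_change_base i2]
      ring
    · exact (((hd.mul K2).intervalIntegrable _ _).add
        (i2.intervalIntegrable.continuousOn_mul hc.continuousOn)).sub
        (((hd'.neg.mul K1).intervalIntegrable _ _).add
        (i1.intervalIntegrable.continuousOn_mul hc'.continuousOn))
    · exact (hd.mul continuous_const).intervalIntegrable _ _
    · exact (((hd.mul K2).intervalIntegrable _ _).add
        (i2.intervalIntegrable.continuousOn_mul hc.continuousOn))
    · exact (((hd'.neg.mul K1).intervalIntegrable _ _).add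
        (i1.intervalIntegrable.continuousOn_mul hc'.continuousOn))
  rw [key, ← p1, ← p2, p3, greenSol, integral_change_base i2]
  ring

/-- Here the terms containing `k` do not cancel: their coefficient is the Wronskian, that is the
constant `leftSol α β 1`. -/
theorem greenSolDeriv_eq (hk : Integrable k) (hs : ∀ t ∉ Icc (-1 : ℝ) 1, k t = 0) (x : ℝ) :
    greenSolDeriv α β k x = greenSolDeriv α β k (-1) + ∫ t in (-1 : ℝ)..x,
      ((α * (t : ℂ) ^ 2 + β) * greenSol α β k t + leftSol α β 1 * k t) := by
  have i1 := integrable_leftSol_mul (α := α) (β := β) hk hs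
  have i2 := integrable_leftSol_neg_mul (α := α) (β := β) hk hs
  have hd := (continuous_leftSolDeriv α β).comp Complex.continuous_ofReal
  have hd' := (continuous_leftSolDeriv α β).comp Complex.continuous_ofReal.neg
  have hc := (continuous_leftSol α β).comp Complex.continuous_ofReal
  have hc' := (continuous_leftSol α β).comp Complex.continuous_ofReal.neg
  have hq : Continuous fun t : ℝ => α * (t : ℂ) ^ 2 + β := by fun_prop
  have K1 := intervalIntegral.continuous_primitive
    (fun a b => i1.intervalIntegrable (a := a) (b := b)) (-1)
  have K2 := intervalIntegral.continuous_primitive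
    (fun a b => i2.intervalIntegrable (a := a) (b := b)) (-1)
  have p1 := mul_integral_eq_integral (a := fun x : ℝ => leftSolDeriv α β x)
    (fun x => (hasDerivAt_leftSolDeriv α β x).comp_ofReal) (hq.mul hc) i2 (-1) x
  have p2 := mul_integral_eq_integral (a := fun x : ℝ => leftSolDeriv α β (-x))
    (fun x => (hasDerivAt_leftSolDeriv_neg α β x).comp_ofReal) (hq.mul hc').neg i1 (-1) x
  have p3 := intervalIntegral.integral_eq_sub_of_hasDerivAt (a := -1) (b := x)
    (fun x _ => (hasDerivAt_leftSolDeriv α β x).comp_ofReal) ((hq.mul hc).intervalIntegrable _ _)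
  simp only [Complex.ofReal_neg, Complex.ofReal_one, leftSolDeriv_neg_one] at p3
  have key : (∫ t in (-1 : ℝ)..x,
        ((α * (t : ℂ) ^ 2 + β) * greenSol α β k t + leftSol α β 1 * k t)) =
      (∫ t in (-1 : ℝ)..x, ((α * (t : ℂ) ^ 2 + β) * leftSol α β t *
        (∫ s in (-1 : ℝ)..t, leftSol α β (-s) * k s) +
        leftSolDeriv α β t * (leftSol α β (-t) * k t))) +
      (∫ t in (-1 : ℝ)..x, (-((α * (t : ℂ) ^ 2 + β) * leftSol α β (-t)) *
        (∫ s in (-1 : ℝ)..t, leftSol α β s * k s) +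
        leftSolDeriv α β (-t) * (leftSol α β t * k t))) -
      (∫ t in (-1 : ℝ)..x, (α * (t : ℂ) ^ 2 + β) * leftSol α β t) *
        ∫ s in (-1 : ℝ)..1, leftSol α β (-s) * k s := by
    rw [← intervalIntegral.integral_mul_const, ← intervalIntegral.integral_add,
      ← intervalIntegral.integral_sub]
    · refine intervalIntegral.integral_congr fun t _ => ?_
      simp only [greenSol]
      rw [integral_change_base i2, ← leftSol_wronskian α β t]
      ring
    · exact ((((hq.mul hc).mul K2).intervalIntegrable _ _).add
        (i2.intervalIntegrable.continuousOn_mul hd.continuousOn)).add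
        ((((hq.mul hc').neg.mul K1).intervalIntegrable _ _).add
        (i1.intervalIntegrable.continuousOn_mul hd'.continuousOn))
    · exact ((hq.mul hc).mul continuous_const).intervalIntegrable _ _
    · exact ((((hq.mul hc).mul K2).intervalIntegrable _ _).add
        (i2.intervalIntegrable.continuousOn_mul hd.continuousOn))
    · exact ((((hq.mul hc').neg.mul K1).intervalIntegrable _ _).add
        (i1.intervalIntegrable.continuousOn_mul hd'.continuousOn))
  rw [key, ← p1, ← p2, p3]
  simp only [greenSolDeriv]
  rw [integral_change_base i2, integral_change_base i2]
  simp only [intervalIntegral.integral_same, Complex.ofReal_neg, Complex.ofReal_one,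
    leftSolDeriv_neg_one]
  ring

theorem hasDerivAt_greenSol (hk : Integrable k) (hs : ∀ t ∉ Icc (-1 : ℝ) 1, k t = 0) (x : ℝ) :
    HasDerivAt (greenSol α β k) (greenSolDeriv α β k x) x := by
  rw [show greenSol α β k = fun x => ∫ t in (-1 : ℝ)..x, greenSolDeriv α β k t from
    funext fun x => greenSol_eq hk hs x]
  exact ((continuous_greenSolDeriv hk hs).integral_hasStrictDerivAt (-1) x).hasDerivAt

end Green

theorem continuous_greenSol {α β : ℂ} {k : ℝ → ℂ} (hk : Integrable k)
    (hs : ∀ t ∉ Icc (-1 : ℝ) 1, k t = 0) : Continuous (greenSol α β k) :=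
  continuous_iff_continuousAt.2 fun x => (hasDerivAt_greenSol hk hs x).continuousAt

theorem extZero_eq_zero (f : L2I) : ∀ t ∉ Icc (-1 : ℝ) 1, extZero f t = 0 :=
  fun _ ht => indicator_of_notMem ht _

theorem memLp_greenSol (α β : ℂ) (f : L2I) : MemLp (greenSol α β (extZero f)) 2 intervalMeasure :=
  memLp_of_continuous (continuous_greenSol (integrable_extZero f) (extZero_eq_zero f))

theorem greenSol_add (α β : ℂ) (f g : L2I) (x : ℝ) : greenSol α β (extZero (f + g)) x =
    greenSol α β (extZero f) x + greenSol α β (extZero g) x := by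
  have h : ∀ (q : ℝ → ℂ) (a b : ℝ), Integrable (fun t => q t * extZero f t) →
      Integrable (fun t => q t * extZero g t) → ∫ t in a..b, q t * extZero (f + g) t =
      (∫ t in a..b, q t * extZero f t) + ∫ t in a..b, q t * extZero g t := fun q a b hf hg => by
    rw [← intervalIntegral.integral_add hf.intervalIntegrable hg.intervalIntegrable]
    refine intervalIntegral.integral_congr_ae ?_
    filter_upwards [extZero_add f g] with t ht _
    rw [ht, mul_add]
  rw [greenSol, h (fun t : ℝ => leftSol α β t) _ _
      (integrable_leftSol_mul (integrable_extZero f) (extZero_eq_zero f))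
      (integrable_leftSol_mul (integrable_extZero g) (extZero_eq_zero g)),
    h (fun t : ℝ => leftSol α β (-t)) _ _
      (integrable_leftSol_neg_mul (integrable_extZero f) (extZero_eq_zero f))
      (integrable_leftSol_neg_mul (integrable_extZero g) (extZero_eq_zero g)), greenSol, greenSol]
  ring

theorem greenSol_smul (α β c : ℂ) (f : L2I) (x : ℝ) : greenSol α β (extZero (c • f)) x =
    c * greenSol α β (extZero f) x := by
  have h : ∀ (q : ℝ → ℂ) (a b : ℝ), ∫ t in a..b, q t * extZero (c • f) t =
      c * ∫ t in a..b, q t * extZero f t := fun q a b => by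
    rw [← intervalIntegral.integral_const_mul]
    refine intervalIntegral.integral_congr_ae ?_
    filter_upwards [extZero_smul c f] with t ht _
    rw [ht]; ring
  rw [greenSol, h (fun t : ℝ => leftSol α β t), h (fun t : ℝ => leftSol α β (-t)), greenSol]
  ring

theorem exists_norm_leftSol_le (α β : ℂ) :
    ∃ M : ℝ, 0 ≤ M ∧ ∀ t ∈ Icc (-1 : ℝ) 1, ‖leftSol α β t‖ ≤ M := by
  have hc : Continuous fun t : ℝ => leftSol α β t :=
    (continuous_leftSol α β).comp Complex.continuous_ofReal
  obtain ⟨M, hM⟩ := isCompact_Icc.exists_bound_of_continuousOn (s := Icc (-1 : ℝ) 1) hc.continuousOn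
  exact ⟨M, (norm_nonneg _).trans (hM 0 (by norm_num)), hM⟩

theorem exists_norm_greenSol_le (α β : ℂ) : ∃ C : ℝ, 0 ≤ C ∧ ∀ (f : L2I), ∀ x ∈ Icc (-1 : ℝ) 1,
    ‖greenSol α β (extZero f) x‖ ≤ C * ‖f‖ := by
  obtain ⟨M, hM0, hM⟩ := exists_norm_leftSol_le α β
  obtain ⟨C, hC0, hC⟩ := exists_integral_norm_extZero_le
  have hM' : ∀ t ∈ Icc (-1 : ℝ) 1, ‖leftSol α β (-t)‖ ≤ M := fun t ht => by
    have := hM (-t) ⟨by linarith [ht.2], by linarith [ht.1]⟩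
    simpa using this
  refine ⟨2 * M * (M * C), by positivity, fun f x hx => ?_⟩
  have hint : ∀ (q : ℝ → ℂ) (a b : ℝ), (∀ t ∈ Icc (-1 : ℝ) 1, ‖q t‖ ≤ M) →
      ‖∫ t in a..b, q t * extZero f t‖ ≤ M * (C * ‖f‖) := fun q a b hq => by
    have hb : ∀ t, ‖q t * extZero f t‖ ≤ M * ‖extZero f t‖ := fun t => by
      by_cases ht : t ∈ Icc (-1 : ℝ) 1
      · rw [norm_mul]; gcongr; exact hq t ht
      · simp [extZero_eq_zero f t ht]
    calc ‖∫ t in a..b, q t * extZero f t‖ ≤ ∫ t in uIoc a b, ‖q t * extZero f t‖ :=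
          intervalIntegral.norm_integral_le_integral_norm_uIoc
      _ ≤ ∫ t in uIoc a b, M * ‖extZero f t‖ :=
          integral_mono_of_nonneg (Eventually.of_forall fun t => norm_nonneg _)
            ((integrable_extZero f).norm.const_mul M).integrableOn (Eventually.of_forall hb)
      _ ≤ ∫ t, M * ‖extZero f t‖ := setIntegral_le_integral
          ((integrable_extZero f).norm.const_mul M) (Eventually.of_forall fun t => by positivity)
      _ = M * ∫ t, ‖extZero f t‖ := integral_const_mul _ _
      _ ≤ M * (C * ‖f‖) := by gcongr; exact hC f
  rw [greenSol]
  refine (norm_sub_le _ _).trans ?_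
  rw [norm_mul, norm_mul]
  have e1 := mul_le_mul (hM x hx) (hint (fun t : ℝ => leftSol α β (-t)) 1 x hM') (norm_nonneg _) hM0
  have e2 := mul_le_mul (hM' x hx) (hint (fun t : ℝ => leftSol α β t) (-1) x hM) (norm_nonneg _) hM0
  calc _ ≤ M * (M * (C * ‖f‖)) + M * (M * (C * ‖f‖)) := add_le_add e1 e2
    _ = _ := by ring

/-- `greenSol` as a bounded operator on `L²([-1, 1])`. -/
noncomputable def greenOp (α β : ℂ) : L2I →L[ℂ] L2I :=
  LinearMap.mkContinuousOfExistsBound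
    { toFun := fun f => (memLp_greenSol α β f).toLp _
      map_add' := fun f g => by
        rw [← MemLp.toLp_add]
        exact MemLp.toLp_congr _ _ (Eventually.of_forall (greenSol_add α β f g))
      map_smul' := fun c f => by
        rw [RingHom.id_apply, ← MemLp.toLp_const_smul]
        exact MemLp.toLp_congr _ _ (Eventually.of_forall (greenSol_smul α β c f)) } (by
    obtain ⟨C, hC0, hC⟩ := exists_norm_greenSol_le α β
    refine ⟨(measureUnivNNReal intervalMeasure : ℝ) ^ (2 : ENNReal).toReal⁻¹ * C, fun f => ?_⟩
    rw [mul_assoc]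
    refine Lp.norm_le_of_ae_bound (by positivity) ?_
    filter_upwards [(memLp_greenSol α β f).coeFn_toLp, self_mem_ae_restrict measurableSet_Icc]
      with x h1 hx
    exact (congrArg norm h1).trans_le (hC f x hx))

theorem greenOp_apply (α β : ℂ) (f : L2I) : greenOp α β f = (memLp_greenSol α β f).toLp _ := rfl

/-- `greenSol` solves `U'' = (α x² + β) U + charFun h E * k`, so `(P^h - E) U = -h² charFun h E *
k`; the scalar in front of `f` is the inverse of this factor. -/
theorem pGraph_greenOp {h : ℝ} (hh : h ≠ 0) {E : ℂ} (hD : charFun h E ≠ 0) (f : L2I) :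
    PGraph h (greenOp (quadCoeff h) (constCoeff h E) ((-((h : ℂ) ^ 2 * charFun h E)⁻¹) • f))
      (f + E • greenOp (quadCoeff h) (constCoeff h E) ((-((h : ℂ) ^ 2 * charFun h E)⁻¹) • f)) := by
  set c : ℂ := -((h : ℂ) ^ 2 * charFun h E)⁻¹ with hc
  set α := quadCoeff h with hα
  set β := constCoeff h E with hβ
  have hh' : (h : ℂ) ^ 2 ≠ 0 := by exact_mod_cast pow_ne_zero 2 hh
  have hk := integrable_extZero (c • f)
  have hs := extZero_eq_zero (c • f)
  have hq : Continuous fun x : ℝ => (α * (x : ℂ) ^ 2 + β) * greenSol α β (extZero (c • f)) x := by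
    have := continuous_greenSol (α := α) (β := β) hk hs
    fun_prop
  have hG : MemLp (fun x : ℝ => (α * (x : ℂ) ^ 2 + β) * greenSol α β (extZero (c • f)) x +
      leftSol α β 1 * extZero (c • f) x) 2 intervalMeasure :=
    (memLp_of_continuous hq).add ((memLp_extZero (c • f)).const_mul _)
  refine ⟨hG.toLp _, hasDirichletSecondDeriv_toLp (memLp_greenSol α β (c • f)) hG
    (fun x _ => (hasDerivAt_greenSol hk hs x).hasDerivWithinAt)
    (fun x _ => greenSolDeriv_eq hk hs x) greenSol_neg_one greenSol_one, ?_⟩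
  filter_upwards [Lp.coeFn_add f (E • greenOp α β (c • f)), Lp.coeFn_smul E (greenOp α β (c • f)),
    (memLp_greenSol α β (c • f)).coeFn_toLp, hG.coeFn_toLp, extZero_ae (c • f),
    Lp.coeFn_smul c f] with x h1 h2 h3 h4 h5 h6
  rw [h1, Pi.add_apply, h2, Pi.smul_apply, greenOp_apply, h3, h4, h5, h6, Pi.smul_apply,
    smul_eq_mul, smul_eq_mul]
  have hcD : (h : ℂ) ^ 2 * leftSol α β 1 * c = -1 := by
    rw [hc, mul_neg, show leftSol α β 1 = charFun h E from rfl,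
      mul_inv_cancel₀ (mul_ne_zero hh' hD)]
  linear_combination (greenSol α β (extZero (c • f)) x) * sq_mul_coeff hh E x + f x * hcD

/-- Off the zeros of `charFun` the rescaled `greenOp` is a right inverse, and injectivity of `P^h -
E` makes it two-sided. -/
theorem mem_pSpectrum_iff {h : ℝ} (hh : h ≠ 0) (E : ℂ) : E ∈ PSpectrum h ↔ charFun h E = 0 := by
  refine ⟨fun hE => ?_, mem_pSpectrum_of_charFun_eq_zero hh⟩
  by_contra hD
  refine hE ⟨(-((h : ℂ) ^ 2 * charFun h E)⁻¹) • greenOp (quadCoeff h) (constCoeff h E),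
    fun f u => ?_⟩
  rw [smul_apply, ← map_smul]
  have hR := pGraph_greenOp hh hD f
  refine ⟨fun hu => hu ▸ hR, fun hu => ?_⟩
  refine sub_eq_zero.1 (eq_zero_of_pGraph hh hD ?_)
  have := hR.sub hu
  rwa [add_sub_add_left_eq_sub, ← smul_sub] at this

/-! ### The action for large `E` -/

/-- The principal fourth root of `1 - w`. -/
noncomputable def quartRoot (w : ℂ) : ℂ := Complex.exp (Complex.log (1 - w) / 4)

theorem one_sub_mem_slitPlane {w : ℂ} (hw : ‖w‖ < 1) : 1 - w ∈ Complex.slitPlane := by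
  have := (Complex.re_le_norm w).trans_lt hw
  exact Or.inl (by simpa using this)

theorem one_sub_ne_zero {w : ℂ} (hw : ‖w‖ < 1) : 1 - w ≠ 0 :=
  Complex.slitPlane_ne_zero (one_sub_mem_slitPlane hw)

theorem quartRoot_ne_zero (w : ℂ) : quartRoot w ≠ 0 := Complex.exp_ne_zero _

theorem quartRoot_pow_four {w : ℂ} (hw : ‖w‖ < 1) : quartRoot w ^ 4 = 1 - w := by
  rw [quartRoot, ← Complex.exp_nat_mul]
  convert Complex.exp_log (one_sub_ne_zero hw) using 2
  push_cast
  ring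

theorem hasDerivAt_quartRoot {w : ℂ} (hw : ‖w‖ < 1) :
    HasDerivAt quartRoot (-quartRoot w / (4 * (1 - w))) w := by
  have h1 : HasDerivAt (fun w : ℂ => 1 - w) (-1) w := by
    simpa using (hasDerivAt_id w).const_sub 1
  have h2 := ((h1.clog (one_sub_mem_slitPlane hw)).div_const 4).cexp
  refine h2.congr_deriv ?_
  have := one_sub_ne_zero hw
  rw [quartRoot]
  field_simp

/-- The principal square root of `1 - w`. -/
noncomputable def sqrtOneSub (w : ℂ) : ℂ := quartRoot w ^ 2

theorem sqrtOneSub_sq {w : ℂ} (hw : ‖w‖ < 1) : sqrtOneSub w ^ 2 = 1 - w := by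
  rw [sqrtOneSub, ← quartRoot_pow_four hw]; ring

theorem sqrtOneSub_ne_zero (w : ℂ) : sqrtOneSub w ≠ 0 := pow_ne_zero 2 (quartRoot_ne_zero w)

theorem differentiableAt_sqrtOneSub {w : ℂ} (hw : ‖w‖ < 1) : DifferentiableAt ℂ sqrtOneSub w :=
  (hasDerivAt_quartRoot hw).differentiableAt.pow 2

theorem sqrtOneSub_re_pos {w : ℂ} (hw : ‖w‖ < 1) : 0 < (sqrtOneSub w).re := by
  have h : sqrtOneSub w = Complex.exp (Complex.log (1 - w) / 2) := by
    rw [sqrtOneSub, quartRoot, ← Complex.exp_nat_mul]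
    congr 1; push_cast; ring
  rw [h, Complex.exp_re]
  refine mul_pos (Real.exp_pos _) (Real.cos_pos_of_mem_Ioo ?_)
  have him : (Complex.log (1 - w) / 2).im = (1 - w).arg / 2 := by
    rw [show (2 : ℂ) = ((2 : ℝ) : ℂ) by norm_num, Complex.div_ofReal_im, Complex.log_im]
  rw [him]
  have h1 := Complex.neg_pi_lt_arg (1 - w)
  have h2 := (Complex.mem_slitPlane_iff_arg.1 (one_sub_mem_slitPlane hw)).1
  have h3 := lt_of_le_of_ne (Complex.arg_le_pi (1 - w)) h2
  constructor <;> linarith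

/-- From `(√(1-w) - 1)(√(1-w) + 1) = -w`, where the second factor has real part above 1. -/
theorem norm_sqrtOneSub_sub_one_le {w : ℂ} (hw : ‖w‖ < 1) : ‖sqrtOneSub w - 1‖ ≤ ‖w‖ := by
  have h1 : (sqrtOneSub w - 1) * (sqrtOneSub w + 1) = -w := by
    linear_combination sqrtOneSub_sq hw
  have h2 : 1 ≤ ‖sqrtOneSub w + 1‖ := by
    have := Complex.re_le_norm (sqrtOneSub w + 1)
    have := sqrtOneSub_re_pos hw
    simp at *
    linarith
  calc ‖sqrtOneSub w - 1‖ ≤ ‖sqrtOneSub w - 1‖ * ‖sqrtOneSub w + 1‖ :=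
        le_mul_of_one_le_right (norm_nonneg _) h2
    _ = ‖w‖ := by rw [← norm_mul, h1, norm_neg]

theorem half_le_sqrtOneSub_re {w : ℂ} (hw : ‖w‖ ≤ 1 / 2) : 1 / 2 ≤ (sqrtOneSub w).re := by
  have h1 := norm_sqrtOneSub_sub_one_le (hw.trans_lt (by norm_num))
  have h2 := (abs_le.1 ((Complex.abs_re_le_norm _).trans (h1.trans hw))).1
  simp at h2
  linarith

theorem norm_sqrtOneSub_sub_le {w w' : ℂ} (hw : ‖w‖ ≤ 1 / 2) (hw' : ‖w'‖ ≤ 1 / 2) :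
    ‖sqrtOneSub w - sqrtOneSub w'‖ ≤ ‖w - w'‖ := by
  have h1 : (sqrtOneSub w - sqrtOneSub w') * (sqrtOneSub w + sqrtOneSub w') = -(w - w') := by
    linear_combination sqrtOneSub_sq (hw.trans_lt (by norm_num)) -
      sqrtOneSub_sq (hw'.trans_lt (by norm_num))
  have h2 : 1 ≤ ‖sqrtOneSub w + sqrtOneSub w'‖ := by
    have h3 := Complex.re_le_norm (sqrtOneSub w + sqrtOneSub w')
    have h4 := half_le_sqrtOneSub_re hw
    have h5 := half_le_sqrtOneSub_re hw'
    rw [Complex.add_re] at h3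
    linarith
  calc ‖sqrtOneSub w - sqrtOneSub w'‖
      ≤ ‖sqrtOneSub w - sqrtOneSub w'‖ * ‖sqrtOneSub w + sqrtOneSub w'‖ :=
        le_mul_of_one_le_right (norm_nonneg _) h2
    _ = ‖w - w'‖ := by rw [← norm_mul, h1, norm_neg]

theorem one_le_norm_one_add_sqrtOneSub {w : ℂ} (hw : ‖w‖ < 1) : 1 ≤ ‖1 + sqrtOneSub w‖ := by
  have h1 := Complex.re_le_norm (1 + sqrtOneSub w)
  have h2 := sqrtOneSub_re_pos hw
  rw [Complex.add_re, Complex.one_re] at h1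
  linarith

theorem norm_mul_sq_le {η : ℂ} {c t : ℝ} (hη : ‖η‖ ≤ c) (ht : t ∈ Icc (-1 : ℝ) 1) :
    ‖η * (t : ℂ) ^ 2‖ ≤ c := by
  rw [norm_mul, norm_pow, Complex.norm_real, Real.norm_eq_abs, sq_abs]
  have : t ^ 2 ≤ 1 := by nlinarith [ht.1, ht.2]
  nlinarith [norm_nonneg η, sq_nonneg t]

theorem continuousOn_sqrtOneSub_mul_sq {η : ℂ} (hη : ‖η‖ ≤ 1 / 2) :
    ContinuousOn (fun t : ℝ => sqrtOneSub (η * (t : ℂ) ^ 2)) (Icc (-1 : ℝ) 1) := by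
  intro t ht
  have h1 : ContinuousAt sqrtOneSub (η * (t : ℂ) ^ 2) := (differentiableAt_sqrtOneSub
    ((norm_mul_sq_le hη ht).trans_lt (by norm_num))).continuousAt
  exact (h1.comp (f := fun t : ℝ => η * (t : ℂ) ^ 2) (by fun_prop)).continuousWithinAt

/-- The mean of `(1 - η t²)^{1/2}` over `[-1, 1]`. -/
noncomputable def meanRoot (η : ℂ) : ℂ := (1 / 2) * ∫ t in (-1 : ℝ)..1, sqrtOneSub (η * (t : ℂ) ^ 2)

/-- The function `κ` with `meanRoot η = 1 - η κ(η)`. -/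
noncomputable def meanRootSlope (η : ℂ) : ℂ :=
  (1 / 2) * ∫ t in (-1 : ℝ)..1, (t : ℂ) ^ 2 / (1 + sqrtOneSub (η * (t : ℂ) ^ 2))

theorem one_add_sqrtOneSub_ne_zero {w : ℂ} (hw : ‖w‖ < 1) : 1 + sqrtOneSub w ≠ 0 :=
  norm_pos_iff.1 (zero_lt_one.trans_le (one_le_norm_one_add_sqrtOneSub hw))

theorem intervalIntegrable_slope {η : ℂ} (hη : ‖η‖ ≤ 1 / 2) : IntervalIntegrable
    (fun t : ℝ => (t : ℂ) ^ 2 / (1 + sqrtOneSub (η * (t : ℂ) ^ 2))) volume (-1) 1 := by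
  refine ContinuousOn.intervalIntegrable ?_
  rw [uIcc_of_le (by norm_num)]
  exact ContinuousOn.div (by fun_prop) (continuousOn_const.add (continuousOn_sqrtOneSub_mul_sq hη))
    fun t ht => one_add_sqrtOneSub_ne_zero ((norm_mul_sq_le hη ht).trans_lt (by norm_num))

/-- The identity `1 - √(1-w) = w / (1 + √(1-w))` is integrated. It gives an exact first-order
remainder whose slope is bounded and Lipschitz in `η`. -/
theorem meanRoot_eq {η : ℂ} (hη : ‖η‖ ≤ 1 / 2) : meanRoot η = 1 - η * meanRootSlope η := by
  have h : ∫ t in (-1 : ℝ)..1, sqrtOneSub (η * (t : ℂ) ^ 2) = ∫ t in (-1 : ℝ)..1,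
      ((1 : ℂ) - η * ((t : ℂ) ^ 2 / (1 + sqrtOneSub (η * (t : ℂ) ^ 2)))) := by
    refine intervalIntegral.integral_congr fun t ht => ?_
    rw [uIcc_of_le (by norm_num)] at ht
    have hw := (norm_mul_sq_le hη ht).trans_lt (by norm_num : (1 / 2 : ℝ) < 1)
    have h1 := one_add_sqrtOneSub_ne_zero hw
    have h2 := sqrtOneSub_sq hw
    generalize sqrtOneSub (η * (t : ℂ) ^ 2) = r at h1 h2 ⊢
    field_simp
    linear_combination h2
  rw [meanRoot, h, intervalIntegral.integral_sub (by simp) ((intervalIntegrable_slope hη).const_mul _),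
    intervalIntegral.integral_const_mul, meanRootSlope]
  norm_num
  ring

theorem norm_half_integral_le {q : ℝ → ℂ} {C : ℝ} (h : ∀ t ∈ Icc (-1 : ℝ) 1, ‖q t‖ ≤ C) :
    ‖(1 / 2) * ∫ t in (-1 : ℝ)..1, q t‖ ≤ C := by
  have := intervalIntegral.norm_integral_le_of_norm_le_const (a := -1) (b := 1) (f := q) (C := C)
    fun t ht => by
      rw [uIoc_of_le (by norm_num)] at ht
      exact h t (Ioc_subset_Icc_self ht)
  rw [norm_mul]
  norm_num at this ⊢
  linarith

theorem norm_sq_le_one {t : ℝ} (ht : t ∈ Icc (-1 : ℝ) 1) : ‖(t : ℂ) ^ 2‖ ≤ 1 := by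
  simpa using norm_mul_sq_le (η := 1) (c := 1) (by simp) ht

theorem norm_meanRootSlope_le {η : ℂ} (hη : ‖η‖ ≤ 1 / 2) : ‖meanRootSlope η‖ ≤ 1 :=
  norm_half_integral_le fun t ht => by
    rw [norm_div]
    exact div_le_one_of_le₀ ((norm_sq_le_one ht).trans (one_le_norm_one_add_sqrtOneSub
      ((norm_mul_sq_le hη ht).trans_lt (by norm_num)))) (norm_nonneg _)

theorem norm_meanRootSlope_sub_le {η η' : ℂ} (hη : ‖η‖ ≤ 1 / 2) (hη' : ‖η'‖ ≤ 1 / 2) :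
    ‖meanRootSlope η - meanRootSlope η'‖ ≤ ‖η - η'‖ := by
  rw [meanRootSlope, meanRootSlope, ← mul_sub, ← intervalIntegral.integral_sub
    (intervalIntegrable_slope hη) (intervalIntegrable_slope hη')]
  refine norm_half_integral_le fun t ht => ?_
  have w1 := norm_mul_sq_le hη ht
  have w2 := norm_mul_sq_le hη' ht
  have n1 := one_le_norm_one_add_sqrtOneSub (w1.trans_lt (by norm_num))
  have n2 := one_le_norm_one_add_sqrtOneSub (w2.trans_lt (by norm_num))
  have z1 := one_add_sqrtOneSub_ne_zero (w1.trans_lt (by norm_num))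
  have z2 := one_add_sqrtOneSub_ne_zero (w2.trans_lt (by norm_num))
  have h := norm_sqrtOneSub_sub_le w2 w1
  have e : (t : ℂ) ^ 2 / (1 + sqrtOneSub (η * (t : ℂ) ^ 2)) -
      (t : ℂ) ^ 2 / (1 + sqrtOneSub (η' * (t : ℂ) ^ 2)) =
      (t : ℂ) ^ 2 * (sqrtOneSub (η' * (t : ℂ) ^ 2) - sqrtOneSub (η * (t : ℂ) ^ 2)) /
      ((1 + sqrtOneSub (η * (t : ℂ) ^ 2)) * (1 + sqrtOneSub (η' * (t : ℂ) ^ 2))) := by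
    generalize sqrtOneSub (η * (t : ℂ) ^ 2) = r at z1 ⊢
    generalize sqrtOneSub (η' * (t : ℂ) ^ 2) = r' at z2 ⊢
    field_simp
    ring
  rw [e, norm_div, norm_mul, norm_mul]
  have h' : ‖sqrtOneSub (η' * (t : ℂ) ^ 2) - sqrtOneSub (η * (t : ℂ) ^ 2)‖ ≤ ‖η - η'‖ := by
    refine h.trans ?_
    rw [← sub_mul, norm_mul, norm_sub_rev]
    exact mul_le_of_le_one_right (norm_nonneg _) (norm_sq_le_one ht)
  refine (div_le_self (by positivity) (one_le_mul_of_one_le_of_one_le n1 n2)).trans ?_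
  exact (mul_le_of_le_one_left (norm_nonneg _) (norm_sq_le_one ht)).trans h'

/-- This value is the source of the asymptote: `2 i κ(0) = i/3` in `phaseSq_eq`. -/
theorem meanRootSlope_zero : meanRootSlope 0 = 1 / 6 := by
  have : sqrtOneSub 0 = 1 := by simp [sqrtOneSub, quartRoot]
  simp only [meanRootSlope, zero_mul, this]
  rw [intervalIntegral.integral_div]
  have : ∫ t in (-1 : ℝ)..1, (t : ℂ) ^ 2 = 2 / 3 := by
    have h : ∀ t : ℝ, (t : ℂ) ^ 2 = ((t ^ 2 : ℝ) : ℂ) := fun t => by push_cast; rfl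
    simp only [h]
    rw [intervalIntegral.integral_ofReal, integral_pow]
    norm_num
  rw [this]
  norm_num

/-- `E ↦ -S_{-1,1}(E)² / 4` in terms of the action `S_{-1,1}`. -/
noncomputable def phaseSq (E : ℂ) : ℂ := E * meanRoot (Complex.I / E) ^ 2

theorem norm_I_div_le {E : ℂ} (hE : 100 ≤ ‖E‖) : ‖Complex.I / E‖ ≤ 1 / 100 := by
  rw [norm_div, Complex.norm_I]
  exact one_div_le_one_div_of_le (by norm_num) hE

theorem ne_zero_of_large {E : ℂ} (hE : 100 ≤ ‖E‖) : E ≠ 0 :=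
  norm_pos_iff.1 (by linarith)

theorem phaseSq_eq {E : ℂ} (hE : 100 ≤ ‖E‖) : phaseSq E = E - 2 * Complex.I *
    meanRootSlope (Complex.I / E) + Complex.I * (Complex.I / E) * meanRootSlope (Complex.I / E) ^ 2 := by
  have h0 := ne_zero_of_large hE
  rw [phaseSq, meanRoot_eq ((norm_I_div_le hE).trans (by norm_num))]
  field_simp
  ring

theorem norm_phaseSq_sub_le {E : ℂ} (hE : 100 ≤ ‖E‖) :
    ‖phaseSq E - (E - Complex.I / 3)‖ ≤ 3 / ‖E‖ := by
  have hη := (norm_I_div_le hE).trans (by norm_num : (1 / 100 : ℝ) ≤ 1 / 2)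
  have h1 := norm_meanRootSlope_sub_le hη (η' := 0) (by simp)
  have h2 := norm_meanRootSlope_le hη
  rw [meanRootSlope_zero, sub_zero] at h1
  rw [phaseSq_eq hE]
  set κ := meanRootSlope (Complex.I / E)
  have e : E - 2 * Complex.I * κ + Complex.I * (Complex.I / E) * κ ^ 2 - (E - Complex.I / 3) =
      -(2 * Complex.I * (κ - 1 / 6)) + Complex.I * (Complex.I / E) * κ ^ 2 := by ring
  have h3 : ‖Complex.I / E‖ = 1 / ‖E‖ := by rw [norm_div, Complex.norm_I]
  rw [e]
  refine (norm_add_le _ _).trans ?_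
  simp only [norm_neg, norm_mul, norm_pow, Complex.norm_I, Complex.norm_two, mul_one, one_mul]
  have h4 : ‖Complex.I / E‖ * ‖κ‖ ^ 2 ≤ ‖Complex.I / E‖ :=
    mul_le_of_le_one_right (norm_nonneg _) (pow_le_one₀ (norm_nonneg _) h2)
  rw [show 3 / ‖E‖ = 2 * ‖Complex.I / E‖ + ‖Complex.I / E‖ by rw [h3]; ring]
  linarith

/-- The correction depends on `E` only through `i/E`, which is Lipschitz with constant 1/100 in this
region. The estimate yields uniqueness and continuity of the graph `b`, and the two-sided control of
`phaseSq` on small circles. -/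
theorem norm_phaseSq_sub_sub_le {E E' : ℂ} (hE : 100 ≤ ‖E‖) (hE' : 100 ≤ ‖E'‖) :
    ‖(phaseSq E - phaseSq E') - (E - E')‖ ≤ 1 / 4 * ‖E - E'‖ := by
  have hη := (norm_I_div_le hE).trans (by norm_num : (1 / 100 : ℝ) ≤ 1 / 2)
  have hη' := (norm_I_div_le hE').trans (by norm_num : (1 / 100 : ℝ) ≤ 1 / 2)
  have h1 := norm_meanRootSlope_sub_le hη hη'
  have h2 := norm_meanRootSlope_le hη
  have h2' := norm_meanRootSlope_le hη'
  have z := ne_zero_of_large hE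
  have z' := ne_zero_of_large hE'
  have hd : ‖Complex.I / E - Complex.I / E'‖ ≤ 1 / 100 * ‖E - E'‖ := by
    have : Complex.I / E - Complex.I / E' = Complex.I / E * ((E' - E) / E') := by
      field_simp
    rw [this, norm_mul, norm_div (E' - E), norm_sub_rev]
    exact mul_le_mul (norm_I_div_le hE) (div_le_self (norm_nonneg _) (by linarith))
      (by positivity) (by norm_num)
  rw [phaseSq_eq hE, phaseSq_eq hE']
  set κ := meanRootSlope (Complex.I / E)
  set κ' := meanRootSlope (Complex.I / E')
  set η := Complex.I / E
  set η' := Complex.I / E'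
  have e : E - 2 * Complex.I * κ + Complex.I * η * κ ^ 2 -
      (E' - 2 * Complex.I * κ' + Complex.I * η' * κ' ^ 2) - (E - E') =
      -(2 * Complex.I * (κ - κ')) + (Complex.I * ((η - η') * κ ^ 2) +
        Complex.I * (η' * ((κ - κ') * (κ + κ')))) := by ring
  rw [e]
  refine (norm_add_le _ _).trans ((add_le_add_right (norm_add_le _ _) _).trans ?_)
  simp only [norm_neg, norm_mul, norm_pow, Complex.norm_I, Complex.norm_two, mul_one, one_mul]
  have h4 : ‖η - η'‖ * ‖κ‖ ^ 2 ≤ ‖η - η'‖ :=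
    mul_le_of_le_one_right (norm_nonneg _) (pow_le_one₀ (norm_nonneg _) h2)
  have h5 : ‖κ + κ'‖ ≤ 2 := (norm_add_le _ _).trans (by linarith)
  have h6 : ‖η'‖ * (‖κ - κ'‖ * ‖κ + κ'‖) ≤ 1 / 2 * (‖κ - κ'‖ * 2) := by gcongr
  linarith [norm_nonneg (E - E')]

/-- Every determination integrates to a square root of `-4 phaseSq E`, and a complex number has real
part 0 exactly when its square is real and nonpositive. -/
theorem mem_gamma_iff {E : ℂ} (hE : 100 ≤ ‖E‖) :
    E ∈ Gamma ↔ (phaseSq E).im = 0 ∧ 0 ≤ (phaseSq E).re := by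
  have z := ne_zero_of_large hE
  have hη := (norm_I_div_le hE).trans (by norm_num : (1 / 100 : ℝ) ≤ 1 / 2)
  obtain ⟨s, hs⟩ : ∃ s : ℂ, s ^ 2 = -E := IsAlgClosed.exists_pow_nat_eq _ (by norm_num)
  have hs0 : s ≠ 0 := fun h => z (by rw [h] at hs; simpa using hs.symm)
  let r : ℝ → ℂ := fun t => s * sqrtOneSub (Complex.I / E * (t : ℂ) ^ 2)
  have hrc : ContinuousOn r (Icc (-1 : ℝ) 1) :=
    continuousOn_const.mul (continuousOn_sqrtOneSub_mul_sq hη)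
  have hr2 : ∀ t ∈ Icc (-1 : ℝ) 1, r t ^ 2 = Complex.I * (t : ℂ) ^ 2 - E := fun t ht => by
    simp only [r]
    rw [mul_pow, hs, sqrtOneSub_sq ((norm_mul_sq_le hη ht).trans_lt (by norm_num))]
    field_simp
    ring
  have hrI : ∫ t in (-1 : ℝ)..1, r t = 2 * s * meanRoot (Complex.I / E) := by
    simp only [r]
    rw [intervalIntegral.integral_const_mul, meanRoot]
    ring
  have hSq : ∀ S : ℂ, (S = 2 * s * meanRoot (Complex.I / E) ∨
      S = -(2 * s * meanRoot (Complex.I / E))) → S ^ 2 = -4 * phaseSq E := by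
    rintro S (rfl | rfl) <;> rw [phaseSq] <;>
      linear_combination 4 * meanRoot (Complex.I / E) ^ 2 * hs
  have hre : ∀ S : ℂ, S ^ 2 = -4 * phaseSq E →
      (S.re = 0 ↔ (phaseSq E).im = 0 ∧ 0 ≤ (phaseSq E).re) := fun S hS => by
    have h1 := congrArg Complex.re hS
    have h2 := congrArg Complex.im hS
    simp [pow_two] at h1 h2
    constructor
    · intro h
      rw [h] at h1 h2
      constructor <;> nlinarith [mul_self_nonneg S.im]
    · rintro ⟨h3, h4⟩
      rw [h3] at h2
      have h5 : S.re * S.im = 0 := by linarith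
      rcases mul_eq_zero.1 h5 with h | h
      · exact h
      · rw [h] at h1
        have : S.re * S.re = 0 := by nlinarith [mul_self_nonneg S.re]
        exact mul_self_eq_zero.1 this
  constructor
  · rintro ⟨S, ⟨q, hqc, hq2, rfl⟩, hS⟩
    refine (hre _ (hSq _ ?_)).1 hS
    -- Two continuous square roots of the same nonvanishing function on a connected set agree up to
    -- a global sign.
    have hcase := isPreconnected_Icc.eq_or_eq_neg_of_sq_eq hqc hrc
      (fun t ht => by simp only [Pi.pow_apply, hq2 t ht, hr2 t ht])
      (fun {t} _ => mul_ne_zero hs0 (sqrtOneSub_ne_zero _))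
    rw [← hrI, ← intervalIntegral.integral_neg]
    refine hcase.imp (fun h => ?_) (fun h => ?_) <;>
    · refine intervalIntegral.integral_congr fun t ht => ?_
      rw [uIcc_of_le (by norm_num)] at ht
      exact h ht
  · intro h
    exact ⟨_, ⟨r, hrc, hr2, rfl⟩, (hre _ (hSq _ (Or.inl hrI))).2 h⟩

/-- The graph of a function over a half line of real parts describes `Gamma` near infinity. -/
theorem exists_gamma_asymptotics : ∃ (A C R : ℝ) (b : ℝ → ℝ), 0 < A ∧ 0 < C ∧ 0 < R ∧
      ContinuousOn b (Ici A) ∧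
      (∀ a : ℝ, A ≤ a → ∀ y : ℝ, ((a : ℂ) + (y : ℂ) * Complex.I ∈ Gamma ↔ y = b a)) ∧
      (∀ a : ℝ, A ≤ a → |b a - 1 / 3| ≤ C / a) ∧
      (∀ E : ℂ, E ∈ Gamma → R ≤ ‖E‖ → A ≤ E.re) := by
  let e : ℝ → ℝ → ℂ := fun a y => (a : ℂ) + (y : ℂ) * Complex.I
  have ere : ∀ a y, (e a y).re = a := fun a y => by simp [e]
  have eim : ∀ a y, (e a y).im = y := fun a y => by simp [e]
  have enorm : ∀ a y, a ≤ ‖e a y‖ := fun a y => by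
    have := Complex.re_le_norm (e a y); rwa [ere] at this
  have elarge : ∀ a y, 100 ≤ a → 100 ≤ ‖e a y‖ := fun a y h => h.trans (enorm a y)
  have hapx : ∀ E : ℂ, 100 ≤ ‖E‖ → |(phaseSq E).im - (E.im - 1 / 3)| ≤ 3 / ‖E‖ ∧
      |(phaseSq E).re - E.re| ≤ 3 / ‖E‖ := fun E hE => by
    have h := norm_phaseSq_sub_le hE
    have h1 := (Complex.abs_im_le_norm _).trans h
    have h2 := (Complex.abs_re_le_norm _).trans h
    have i3 : (Complex.I / 3).im = 1 / 3 ∧ (Complex.I / 3).re = 0 := by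
      rw [show (3 : ℂ) = ((3 : ℝ) : ℂ) by norm_num, Complex.div_ofReal_im, Complex.div_ofReal_re]
      simp
    simp only [Complex.sub_im, Complex.sub_re, i3.1, i3.2, sub_zero] at h1 h2
    exact ⟨h1, h2⟩
  have hsmall : ∀ E : ℂ, 100 ≤ ‖E‖ → 3 / ‖E‖ ≤ 3 / 100 := fun E hE => by gcongr
  have hlip : ∀ a y a' y', 100 ≤ a → 100 ≤ a' →
      |(phaseSq (e a y)).im - (phaseSq (e a' y')).im - (y - y')| ≤
        1 / 4 * (|a - a'| + |y - y'|) := fun a y a' y' ha ha' => by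
    have h := norm_phaseSq_sub_sub_le (elarge a y ha) (elarge a' y' ha')
    have h1 := (Complex.abs_im_le_norm _).trans h
    have h2 := Complex.norm_le_abs_re_add_abs_im (e a y - e a' y')
    simp only [Complex.sub_im, Complex.sub_re, ere, eim] at h1 h2
    linarith
  have hcont : ∀ a, 100 ≤ a → Continuous fun y => (phaseSq (e a y)).im := fun a ha => by
    refine LipschitzWith.continuous (K := 2) (LipschitzWith.of_dist_le_mul fun y y' => ?_)
    have h := hlip a y a y' ha ha
    rw [sub_self, abs_zero, zero_add] at h
    have h3 := abs_sub_abs_le_abs_sub ((phaseSq (e a y)).im - (phaseSq (e a y')).im) (y - y')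
    rw [Real.dist_eq, Real.dist_eq]
    push_cast
    linarith [abs_nonneg (y - y')]
  -- On the vertical line of abscissa `a` the imaginary part is `y - 1/3` up to 3/100, so it changes
  -- sign between `y = 0` and `y = 1`.
  have hex : ∀ a : ℝ, ∃ y : ℝ, 100 ≤ a → (phaseSq (e a y)).im = 0 := fun a => by
    by_cases ha : 100 ≤ a
    · have h0 := abs_le.1 ((hapx _ (elarge a 0 ha)).1.trans (hsmall _ (elarge a 0 ha)))
      have h1 := abs_le.1 ((hapx _ (elarge a 1 ha)).1.trans (hsmall _ (elarge a 1 ha)))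
      rw [eim] at h0 h1
      obtain ⟨y, -, hy⟩ := intermediate_value_Icc (zero_le_one (α := ℝ)) (hcont a ha).continuousOn
        (show (0 : ℝ) ∈ Icc _ _ from ⟨by linarith, by linarith⟩)
      exact ⟨y, fun _ => hy⟩
    · exact ⟨0, fun h => absurd h ha⟩
  choose b hb using hex
  -- The Lipschitz estimate gives `(3/4)|y - y'| ≤ (1/4)|a - a'|`. The case `a = a'` is uniqueness;
  -- in general it makes `b` Lipschitz.
  have hbl : ∀ a a' y y', 100 ≤ a → 100 ≤ a' → (phaseSq (e a y)).im = 0 →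
      (phaseSq (e a' y')).im = 0 → |y - y'| ≤ |a - a'| := fun a a' y y' ha ha' h h' => by
    have h1 := hlip a y a' y' ha ha'
    rw [h, h', sub_self, zero_sub, abs_neg] at h1
    linarith [abs_nonneg (a - a')]
  refine ⟨100, 3, 103, b, by norm_num, by norm_num, by norm_num, ?_, ?_, ?_, ?_⟩
  · refine LipschitzOnWith.continuousOn (K := 1) (LipschitzOnWith.of_dist_le_mul fun a ha a' ha' => ?_)
    rw [Real.dist_eq, Real.dist_eq]
    simpa using hbl a a' _ _ ha ha' (hb a ha) (hb a' ha')
  · intro a ha y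
    change e a y ∈ Gamma ↔ y = b a
    rw [mem_gamma_iff (elarge a y ha)]
    constructor
    · rintro ⟨h, -⟩
      have := hbl a a y (b a) ha ha h (hb a ha)
      rw [sub_self, abs_zero] at this
      exact sub_eq_zero.1 (abs_nonpos_iff.1 this)
    · rintro rfl
      refine ⟨hb a ha, ?_⟩
      have h1 := abs_le.1 ((hapx _ (elarge a (b a) ha)).2.trans (hsmall _ (elarge a _ ha)))
      rw [ere] at h1
      linarith
  · intro a ha
    have h1 := (hapx _ (elarge a (b a) ha)).1
    rw [hb a ha, eim, zero_sub, abs_neg] at h1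
    refine h1.trans ?_
    have := enorm a (b a)
    gcongr
  -- On the curve `|Im E| ≤ 1` and `Re E ≥ -3/100`, so `‖E‖ ≥ 103` leaves only `Re E ≥ 102`.
  · intro E hE hR
    have hE1 : 100 ≤ ‖E‖ := by linarith
    obtain ⟨h1, h2⟩ := (mem_gamma_iff hE1).1 hE
    obtain ⟨h3, h4⟩ := hapx E hE1
    have h5 := abs_le.1 (h3.trans (hsmall E hE1))
    have h6 := abs_le.1 (h4.trans (hsmall E hE1))
    rw [h1] at h5
    have h7 := Complex.norm_le_abs_re_add_abs_im E
    have h8 : |E.im| ≤ 1 := abs_le.2 ⟨by linarith, by linarith⟩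
    rcases abs_cases E.re with h | h <;> linarith

/-! ### The Liouville transformation -/

theorem norm_mul_sq_le_of_mem_ball {η z : ℂ} (hη : ‖η‖ ≤ 1 / 100) (hz : ‖z‖ < 2) :
    ‖η * z ^ 2‖ ≤ 1 / 25 := by
  rw [norm_mul, norm_pow]
  have : ‖z‖ ^ 2 ≤ 4 := by nlinarith [norm_nonneg z]
  nlinarith [norm_nonneg η, sq_nonneg ‖z‖]

/-- A path from `-1` to `1` along which the action grows linearly. -/
theorem exists_action_path {η : ℂ} (hη : ‖η‖ ≤ 1 / 100) : ∃ z : ℝ → ℂ, z (-1) = -1 ∧ z 1 = 1 ∧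
    ∀ s ∈ Icc (-1 : ℝ) 1, ‖z s‖ < 2 ∧
      HasDerivAt z (meanRoot η / sqrtOneSub (η * z s ^ 2)) s := by
  have hw : ∀ z ∈ Metric.ball (0 : ℂ) 2, ‖η * z ^ 2‖ ≤ 1 / 25 := fun z hz =>
    norm_mul_sq_le_of_mem_ball hη (by simpa using hz)
  have hr : DifferentiableOn ℂ (fun z => sqrtOneSub (η * z ^ 2)) (Metric.ball 0 2) := fun z hz =>
    ((differentiableAt_sqrtOneSub ((hw z hz).trans_lt (by norm_num))).comp
      (f := fun z : ℂ => η * z ^ 2) z (by fun_prop)).differentiableWithinAt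
  -- The action `ζ`, a primitive of `√(1 - η z²)`, is within Lipschitz distance 1/20 of the
  -- identity, hence invertible on the disc. The path is the preimage under `ζ` of the segment from
  -- `ζ(-1)` to `ζ(1)`, and in general leaves the real axis.
  obtain ⟨ζ, hζ0, hζ⟩ := hr.isExactOn_ball.with_val_at 0 0
  have hlin : ApproximatesLinearOn ζ ((ContinuousLinearEquiv.refl ℂ ℂ : ℂ ≃L[ℂ] ℂ) : ℂ →L[ℂ] ℂ)
      (Metric.ball 0 2) (1 / 20) := by
    intro x hx y hy
    have := (convex_ball (0 : ℂ) 2).norm_image_sub_le_of_norm_hasDerivWithin_le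
      (f := fun z => ζ z - z) (f' := fun z => sqrtOneSub (η * z ^ 2) - 1) (C := 1 / 20)
      (fun z hz => ((hζ z hz).sub (hasDerivAt_id z)).hasDerivWithinAt)
      (fun z hz => (norm_sqrtOneSub_sub_one_le ((hw z hz).trans_lt (by norm_num))).trans
        ((hw z hz).trans (by norm_num))) hy hx
    simp only [ContinuousLinearEquiv.coe_refl, ContinuousLinearMap.id_apply]
    rw [show ζ x - ζ y - (x - y) = ζ x - x - (ζ y - y) by ring]
    simpa using this
  have hN : ‖(((ContinuousLinearEquiv.refl ℂ ℂ).symm : ℂ ≃L[ℂ] ℂ) : ℂ →L[ℂ] ℂ)‖₊ = 1 := by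
    rw [ContinuousLinearEquiv.refl_symm, ContinuousLinearEquiv.coe_refl]
    exact NNReal.eq ContinuousLinearMap.norm_id
  have hc : Subsingleton ℂ ∨
      (1 / 20 : NNReal) < ‖(((ContinuousLinearEquiv.refl ℂ ℂ).symm : ℂ ≃L[ℂ] ℂ) : ℂ →L[ℂ] ℂ)‖₊⁻¹ := by
    right
    rw [hN, inv_one, ← NNReal.coe_lt_coe]
    norm_num
  let Φ := hlin.toOpenPartialHomeomorph ζ _ hc Metric.isOpen_ball
  have hΦ : ∀ x, Φ x = ζ x := fun x => rfl
  have hsrc : Φ.source = Metric.ball 0 2 := rfl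
  -- The image contains the ball of radius `(1 - 1/20) · 3/2 > 7/5`, while `|ζ(±1)| ≤ 21/20`; by
  -- convexity the whole segment is inside.
  have htgt : Metric.closedBall (0 : ℂ) (7 / 5) ⊆ Φ.target := by
    have := hlin.closedBall_subset_target hc Metric.isOpen_ball (b := 0) (ε := 3 / 2) (by norm_num)
      (Metric.closedBall_subset_ball (by norm_num))
    rw [hζ0, hN] at this
    refine (Metric.closedBall_subset_closedBall ?_).trans this
    push_cast
    norm_num
  have hend : ∀ x ∈ Metric.ball (0 : ℂ) 2, ‖ζ x‖ ≤ 21 / 20 * ‖x‖ := fun x hx => by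
    have h1 := hlin x hx 0 (by simp)
    simp only [hζ0, sub_zero, ContinuousLinearEquiv.coe_refl, ContinuousLinearMap.id_apply] at h1
    push_cast at h1
    have h2 := norm_add_le (ζ x - x) x
    rw [sub_add_cancel] at h2
    linarith
  have hm1 : (1 : ℂ) ∈ Metric.ball (0 : ℂ) 2 := by simp
  have hm2 : (-1 : ℂ) ∈ Metric.ball (0 : ℂ) 2 := by simp
  have hg : meanRoot η = (ζ 1 - ζ (-1)) / 2 := by
    have hsub : ∀ t ∈ Icc (-1 : ℝ) 1, (t : ℂ) ∈ Metric.ball (0 : ℂ) 2 := fun t ht => by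
      rw [mem_ball_zero_iff, Complex.norm_real, Real.norm_eq_abs]
      exact (abs_le.2 ht).trans_lt (by norm_num)
    have := intervalIntegral.integral_eq_sub_of_hasDerivAt (a := -1) (b := 1)
      (f := fun t : ℝ => ζ t) (f' := fun t : ℝ => sqrtOneSub (η * (t : ℂ) ^ 2))
      (fun t ht => by
        rw [uIcc_of_le (by norm_num)] at ht
        exact (hζ t (hsub t ht)).comp_ofReal)
      (by
        refine ContinuousOn.intervalIntegrable ?_
        rw [uIcc_of_le (by norm_num)]
        exact continuousOn_sqrtOneSub_mul_sq (hη.trans (by norm_num)))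
    rw [meanRoot, this]
    push_cast
    ring
  have hp : ∀ s ∈ Icc (-1 : ℝ) 1, (ζ 1 + ζ (-1)) / 2 + meanRoot η * s ∈ Φ.target := fun s hs => by
    refine htgt ?_
    have e : (ζ 1 + ζ (-1)) / 2 + meanRoot η * s =
        ((1 + s) / 2 : ℝ) • ζ 1 + ((1 - s) / 2 : ℝ) • ζ (-1) := by
      rw [hg, Complex.real_smul, Complex.real_smul]; push_cast; ring
    rw [e]
    refine convex_closedBall (0 : ℂ) (7 / 5) ?_ ?_ (by linarith [hs.1]) (by linarith [hs.2]) (by ring)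
    · rw [mem_closedBall_zero_iff]; refine (hend 1 hm1).trans ?_; norm_num
    · rw [mem_closedBall_zero_iff]; refine (hend _ hm2).trans ?_; norm_num
  refine ⟨fun s => Φ.symm ((ζ 1 + ζ (-1)) / 2 + meanRoot η * s), ?_, ?_, fun s hs => ?_⟩
  · have : (ζ 1 + ζ (-1)) / 2 + meanRoot η * ((-1 : ℝ) : ℂ) = Φ (-1) := by
      rw [hg, hΦ]; push_cast; ring
    simp only [this]
    exact Φ.left_inv (by rw [hsrc]; exact hm2)
  · have : (ζ 1 + ζ (-1)) / 2 + meanRoot η * ((1 : ℝ) : ℂ) = Φ 1 := by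
      rw [hg, hΦ]; push_cast; ring
    simp only [this]
    exact Φ.left_inv (by rw [hsrc]; exact hm1)
  · have hmem : Φ.symm ((ζ 1 + ζ (-1)) / 2 + meanRoot η * s) ∈ Metric.ball (0 : ℂ) 2 := by
      rw [← hsrc]; exact Φ.map_target (hp s hs)
    refine ⟨by simpa using hmem, ?_⟩
    have hd := Φ.hasDerivAt_symm (hp s hs) (sqrtOneSub_ne_zero _) (hζ _ hmem)
    have hl : HasDerivAt (fun s : ℝ => (ζ 1 + ζ (-1)) / 2 + meanRoot η * s) (meanRoot η) s := by
      simpa using ((hasDerivAt_id (s : ℂ)).comp_ofReal.const_mul (meanRoot η)).const_add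
        ((ζ 1 + ζ (-1)) / 2)
    exact (hd.comp s hl).congr_deriv (inv_mul_eq_div _ _)

/-- The potential that the Liouville transformation produces. -/
noncomputable def liouvillePotential (η z : ℂ) : ℂ :=
  -(η / (2 * (1 - η * z ^ 2) ^ 2)) - 5 * η ^ 2 * z ^ 2 / (4 * (1 - η * z ^ 2) ^ 3)

theorem norm_liouvillePotential_le {η z : ℂ} (hη : ‖η‖ ≤ 1 / 100) (hz : ‖z‖ < 2) :
    ‖liouvillePotential η z‖ ≤ 1 / 4 := by
  have hw := norm_mul_sq_le_of_mem_ball hη hz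
  have hq : 1 / 2 ≤ ‖1 - η * z ^ 2‖ := by
    have := norm_sub_norm_le (1 : ℂ) (η * z ^ 2)
    rw [norm_one] at this
    linarith
  have hq2 : 1 / 4 ≤ ‖1 - η * z ^ 2‖ ^ 2 := by nlinarith
  have hq3 : 1 / 8 ≤ ‖1 - η * z ^ 2‖ ^ 3 := by
    have := pow_le_pow_left₀ (by norm_num : (0 : ℝ) ≤ 1 / 2) hq 3
    linarith
  rw [liouvillePotential, show 5 * η ^ 2 * z ^ 2 = 5 * (η * (η * z ^ 2)) by ring]
  refine (norm_sub_le _ _).trans ?_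
  have h1 : ‖-(η / (2 * (1 - η * z ^ 2) ^ 2))‖ ≤ 1 / 50 := by
    rw [norm_neg, norm_div, norm_mul, norm_pow, Complex.norm_two, div_le_iff₀ (by positivity)]
    linarith
  have h2 : ‖5 * (η * (η * z ^ 2)) / (4 * (1 - η * z ^ 2) ^ 3)‖ ≤ 1 / 50 := by
    have h3 : ‖η * (η * z ^ 2)‖ ≤ 1 / 100 * (1 / 25) := by rw [norm_mul]; gcongr
    rw [norm_div, norm_mul 5, norm_mul 4, norm_pow, show ‖(5 : ℂ)‖ = 5 by simp,
      show ‖(4 : ℂ)‖ = 4 by simp, div_le_iff₀ (by positivity)]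
    linarith
  linarith

/-- With `q = 1 - η z²`, the amplitude `q^{1/4}` cancels the first-order term created by `dz/ds = g
/ q^{1/2}`. The large parameter then appears only through the constant `Λ g²`, and
`liouvillePotential` does not involve `Λ`. For `Λ = E/h²` and `g = meanRoot η` this constant is
`phaseSq E / h²`. -/
theorem liouville_transform {η Λ g : ℂ} (hη : ‖η‖ ≤ 1 / 100) {u u' : ℂ → ℂ}
    (hu : ∀ z, HasDerivAt u (u' z) z) (hu' : ∀ z, HasDerivAt u' (-Λ * (1 - η * z ^ 2) * u z) z)
    {z : ℝ → ℂ} {s : ℝ} (hz2 : ‖z s‖ < 2)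
    (hz : HasDerivAt z (g / sqrtOneSub (η * z s ^ 2)) s) :
    HasDerivAt (fun s => quartRoot (η * z s ^ 2) * u (z s))
      (g / quartRoot (η * z s ^ 2) * (u' (z s) - η * z s * u (z s) / (2 * (1 - η * z s ^ 2)))) s ∧
    HasDerivAt (fun s => g / quartRoot (η * z s ^ 2) *
        (u' (z s) - η * z s * u (z s) / (2 * (1 - η * z s ^ 2))))
      ((g ^ 2 * liouvillePotential η (z s) - Λ * g ^ 2) *
        (quartRoot (η * z s ^ 2) * u (z s))) s := by
  have hw := (norm_mul_sq_le_of_mem_ball hη hz2).trans_lt (by norm_num : (1 / 25 : ℝ) < 1)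
  have hq := one_sub_ne_zero hw
  have hρ := quartRoot_ne_zero (η * z s ^ 2)
  have hρ4 := quartRoot_pow_four hw
  set x := z s with hx
  have dw : HasDerivAt (fun z : ℂ => η * z ^ 2) (2 * η * x) x := by
    refine ((hasDerivAt_pow 2 x).const_mul η).congr_deriv ?_
    push_cast; ring
  have dρ : HasDerivAt (fun z : ℂ => quartRoot (η * z ^ 2))
      (-quartRoot (η * x ^ 2) / (4 * (1 - η * x ^ 2)) * (2 * η * x)) x :=
    HasDerivAt.comp (h₂ := quartRoot) (h := fun z : ℂ => η * z ^ 2) x (hasDerivAt_quartRoot hw) dw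
  have dq : HasDerivAt (fun z : ℂ => 2 * (1 - η * z ^ 2)) (2 * -(2 * η * x)) x :=
    (dw.const_sub 1).const_mul 2
  have d1 := (dρ.mul (hu x)).scomp s hz
  have dt : HasDerivAt (fun z : ℂ => η * z * u z / (2 * (1 - η * z ^ 2)))
      (((η * u x + η * x * u' x) * (2 * (1 - η * x ^ 2)) - η * x * u x * (2 * -(2 * η * x))) /
        (2 * (1 - η * x ^ 2)) ^ 2) x := by
    have hη1 : HasDerivAt (fun z : ℂ => η * z) η x := by
      simpa using (hasDerivAt_id x).const_mul η
    exact (hη1.mul (hu x)).div dq (mul_ne_zero two_ne_zero hq)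
  have d2 := (((hasDerivAt_const x g).div dρ hρ).mul ((hu' x).sub dt)).scomp s hz
  constructor
  · refine d1.congr_deriv ?_
    rw [smul_eq_mul, sqrtOneSub]
    field_simp
    ring
  · refine d2.congr_deriv ?_
    rw [smul_eq_mul, sqrtOneSub, liouvillePotential]
    simp only [Pi.sub_apply, Pi.div_apply]
    generalize quartRoot (η * x ^ 2) = ρ at *
    have hq' : 1 - η * x ^ 2 = ρ ^ 4 := hρ4.symm
    rw [hq']
    field_simp
    ring

theorem norm_meanRoot_sub_one_le {η : ℂ} (hη : ‖η‖ ≤ 1 / 100) : ‖meanRoot η - 1‖ ≤ 1 / 100 := by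
  have h := hη.trans (by norm_num : (1 / 100 : ℝ) ≤ 1 / 2)
  rw [meanRoot_eq h, show 1 - η * meanRootSlope η - 1 = -(η * meanRootSlope η) by ring, norm_neg,
    norm_mul]
  exact (mul_le_of_le_one_right (norm_nonneg _) (norm_meanRootSlope_le h)).trans hη

theorem norm_bounds_of_near_one {w : ℂ} (h : ‖w - 1‖ ≤ 1 / 100) :
    99 / 100 ≤ ‖w‖ ∧ ‖w‖ ≤ 101 / 100 := by
  have h1 := norm_add_le (w - 1) 1
  have h2 := norm_sub_norm_le 1 (1 - w)
  rw [norm_sub_rev 1 w] at h2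
  rw [norm_one] at h1 h2
  rw [sub_add_cancel] at h1
  rw [sub_sub_cancel] at h2
  constructor <;> linarith

/-- Reduction of `P^h u = E u` to a bounded perturbation of `-d²/ds²` on `[-1, 1]`. -/
theorem exists_normal_form {h : ℝ} (hh : h ≠ 0) {E : ℂ} (hE : 100 ≤ ‖E‖) :
    ∃ (b : ℂ) (R v v' : ℝ → ℂ), 1 / 2 ≤ ‖b‖ ∧ ‖b‖ ≤ 2 ∧ ContinuousOn R (Icc (-1) 1) ∧
      (∀ s ∈ Icc (-1 : ℝ) 1, ‖R s‖ ≤ 1) ∧ (∀ s ∈ Icc (-1 : ℝ) 1, HasDerivAt v (v' s) s) ∧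
      (∀ s ∈ Icc (-1 : ℝ) 1, HasDerivAt v' ((R s - phaseSq E / (h : ℂ) ^ 2) * v s) s) ∧
      v (-1) = 0 ∧ v' (-1) = 1 ∧ v 1 = b * charFun h E := by
  set η := Complex.I / E with hηdef
  have hη : ‖η‖ ≤ 1 / 100 := norm_I_div_le hE
  have hE0 := ne_zero_of_large hE
  have hh' : (h : ℂ) ≠ 0 := by exact_mod_cast hh
  obtain ⟨z, z0, z1, hz⟩ := exists_action_path hη
  set g := meanRoot η with hg
  have hgb := norm_bounds_of_near_one (norm_meanRoot_sub_one_le hη)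
  have hrb := norm_bounds_of_near_one
    ((norm_sqrtOneSub_sub_one_le (hη.trans_lt (by norm_num))).trans hη)
  have hg0 : g ≠ 0 := norm_pos_iff.1 (by linarith)
  have hρ0 := quartRoot_ne_zero η
  have hu' : ∀ x, HasDerivAt (leftSolDeriv (quadCoeff h) (constCoeff h E))
      (-(E / (h : ℂ) ^ 2) * (1 - η * x ^ 2) * leftSol (quadCoeff h) (constCoeff h E) x) x := fun x => by
    refine (hasDerivAt_leftSolDeriv _ _ x).congr_deriv ?_
    rw [quadCoeff, constCoeff, hηdef]
    field_simp
    ring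
  have hL := fun s hs => liouville_transform (Λ := E / (h : ℂ) ^ 2) (g := g) hη
    (hasDerivAt_leftSol (quadCoeff h) (constCoeff h E)) hu' (hz s hs).1 (hz s hs).2
  have hzc : ContinuousOn z (Icc (-1) 1) := fun s hs => (hz s hs).2.continuousAt.continuousWithinAt
  have hq : ∀ s ∈ Icc (-1 : ℝ) 1, 1 - η * z s ^ 2 ≠ 0 := fun s hs =>
    one_sub_ne_zero ((norm_mul_sq_le_of_mem_ball hη (hz s hs).1).trans_lt (by norm_num))
  -- The factor `quartRoot η / g` normalises the initial slope to 1; together with the amplitude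
  -- `quartRoot η` at `z = 1` it gives `b`.
  refine ⟨sqrtOneSub η / g, fun s => g ^ 2 * liouvillePotential η (z s), _, _, ?_, ?_, ?_,
    fun s hs => ?_, fun s hs => (hL s hs).1.const_mul (quartRoot η / g), fun s hs => ?_, ?_, ?_, ?_⟩
  · rw [norm_div, le_div_iff₀ (by linarith)]; linarith
  · rw [norm_div, div_le_iff₀ (by linarith)]; linarith
  · refine continuousOn_const.mul ?_
    unfold liouvillePotential
    refine ContinuousOn.sub (ContinuousOn.neg (ContinuousOn.div (by fun_prop) (by fun_prop) ?_))
      (ContinuousOn.div (by fun_prop) (by fun_prop) ?_)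
    · exact fun s hs => mul_ne_zero two_ne_zero (pow_ne_zero 2 (hq s hs))
    · exact fun s hs => mul_ne_zero (by norm_num) (pow_ne_zero 3 (hq s hs))
  · rw [norm_mul, norm_pow]
    have h1 := norm_liouvillePotential_le hη (hz s hs).1
    have h2 : ‖g‖ ^ 2 ≤ 4 := by nlinarith [norm_nonneg g]
    nlinarith [norm_nonneg (liouvillePotential η (z s)), sq_nonneg ‖g‖]
  · refine ((hL s hs).2.const_mul (quartRoot η / g)).congr_deriv ?_
    rw [phaseSq]
    ring
  · simp only [z0, leftSol_neg_one, mul_zero]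
  · simp only [z0, leftSol_neg_one, leftSolDeriv_neg_one, mul_zero, zero_div, sub_zero,
      even_two.neg_pow, one_pow, mul_one]
    field_simp
  · simp only [z1, one_pow, mul_one, charFun, sqrtOneSub]
    ring

/-! ### Estimates for `v'' = (R - λ) v` -/

section NormalForm

variable {R v v' : ℝ → ℂ} {lam ω : ℂ}

/-- Dirichlet eigenvalues of `-d²/ds² + R`, `|R| ≤ 1`, lie within distance `1` of `[0, ∞)`. -/
theorem eigenvalue_near_halfline (hRc : ContinuousOn R (Icc (-1) 1))
    (hR : ∀ s ∈ Icc (-1 : ℝ) 1, ‖R s‖ ≤ 1) (hv : ∀ s ∈ Icc (-1 : ℝ) 1, HasDerivAt v (v' s) s)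
    (hv' : ∀ s ∈ Icc (-1 : ℝ) 1, HasDerivAt v' ((R s - lam) * v s) s)
    (h0 : v (-1) = 0) (h0' : v' (-1) = 1) (h1 : v 1 = 0) : |lam.im| ≤ 1 ∧ -1 ≤ lam.re := by
  have hvc : ContinuousOn v (Icc (-1) 1) := fun s hs => (hv s hs).continuousAt.continuousWithinAt
  have hvc' : ContinuousOn v' (Icc (-1) 1) := fun s hs => (hv' s hs).continuousAt.continuousWithinAt
  have hle : (-1 : ℝ) ≤ 1 := by norm_num
  have hI : ∀ {q : ℝ → ℂ}, ContinuousOn q (Icc (-1) 1) → IntervalIntegrable q volume (-1) 1 :=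
    fun hq => ContinuousOn.intervalIntegrable (by rwa [uIcc_of_le hle])
  have hIr : ∀ {q : ℝ → ℝ}, ContinuousOn q (Icc (-1) 1) → IntervalIntegrable q volume (-1) 1 :=
    fun hq => ContinuousOn.intervalIntegrable (by rwa [uIcc_of_le hle])
  have hn : ContinuousOn (fun s => ‖v s‖ ^ 2) (Icc (-1) 1) := hvc.norm.pow 2
  have hn' : ContinuousOn (fun s => ‖v' s‖ ^ 2) (Icc (-1) 1) := hvc'.norm.pow 2
  have hnC : ContinuousOn (fun s => ((‖v s‖ ^ 2 : ℝ) : ℂ)) (Icc (-1) 1) :=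
    Complex.continuous_ofReal.comp_continuousOn hn
  have hnC' : ContinuousOn (fun s => ((‖v' s‖ ^ 2 : ℝ) : ℂ)) (Icc (-1) 1) :=
    Complex.continuous_ofReal.comp_continuousOn hn'
  have hcm : ∀ w : ℂ, w * starRingEnd ℂ w = ((‖w‖ ^ 2 : ℝ) : ℂ) := fun w => by
    rw [Complex.mul_conj, Complex.normSq_eq_norm_sq]
  have hd : ∀ s ∈ uIcc (-1 : ℝ) 1, HasDerivAt (fun s => v' s * starRingEnd ℂ (v s))
      (R s * ((‖v s‖ ^ 2 : ℝ) : ℂ) - lam * ((‖v s‖ ^ 2 : ℝ) : ℂ) + ((‖v' s‖ ^ 2 : ℝ) : ℂ)) s :=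
    fun s hs => by
      rw [uIcc_of_le hle] at hs
      have h := (hv' s hs).mul (hv s hs).star
      refine h.congr_deriv ?_
      rw [← hcm, ← hcm]
      simp only [starRingEnd_apply]
      ring
  have iR : IntervalIntegrable (fun s => R s * ((‖v s‖ ^ 2 : ℝ) : ℂ)) volume (-1) 1 :=
    hI (hRc.mul hnC)
  have il := (hI hnC).const_mul lam
  have hint := intervalIntegral.integral_eq_sub_of_hasDerivAt hd ((iR.sub il).add (hI hnC'))
  rw [intervalIntegral.integral_add (iR.sub il) (hI hnC'), intervalIntegral.integral_sub iR il,
    intervalIntegral.integral_const_mul, intervalIntegral.integral_ofReal,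
    intervalIntegral.integral_ofReal, h0, h1, map_zero, mul_zero, mul_zero, sub_zero] at hint
  set N := ∫ s in (-1 : ℝ)..1, ‖v s‖ ^ 2 with hN
  set K := ∫ s in (-1 : ℝ)..1, ‖v' s‖ ^ 2 with hK
  set J := ∫ s in (-1 : ℝ)..1, R s * ((‖v s‖ ^ 2 : ℝ) : ℂ) with hJ
  have hK0 : 0 ≤ K := intervalIntegral.integral_nonneg hle fun s _ => by positivity
  have hNpos : 0 < N := by
    refine intervalIntegral.integral_pos (by norm_num) hn (fun s _ => by positivity) ?_
    by_contra! hc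
    have hz : ∀ s ∈ Icc (-1 : ℝ) 1, v s = 0 := fun s hs => by
      have := hc s hs
      exact norm_eq_zero.1 (pow_eq_zero_iff two_ne_zero |>.1 (le_antisymm this (by positivity)))
    have hm : (-1 : ℝ) ∈ Icc (-1 : ℝ) 1 := by norm_num
    have d1 := (hv (-1) hm).hasDerivWithinAt (s := Icc (-1 : ℝ) 1)
    have d2 : HasDerivWithinAt v 0 (Icc (-1 : ℝ) 1) (-1) :=
      (hasDerivWithinAt_const (-1 : ℝ) _ (0 : ℂ)).congr hz (hz _ hm)
    have := (uniqueDiffOn_Icc (by norm_num : (-1 : ℝ) < 1) _ hm).eq_deriv _ d1 d2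
    rw [h0'] at this
    exact one_ne_zero this
  have hJN : ‖J‖ ≤ N := by
    refine intervalIntegral.norm_integral_le_of_norm_le hle ?_ (hIr hn)
    refine Eventually.of_forall fun s hs => ?_
    rw [norm_mul, Complex.norm_real, Real.norm_of_nonneg (by positivity)]
    exact mul_le_of_le_one_left (by positivity) (hR s (Ioc_subset_Icc_self hs))
  -- Integrating `v'' v̄` by parts gives `λ ∫|v|² = ∫ R|v|² + ∫|v'|²`. The first term on the right
  -- is at most `∫|v|²` in modulus and the second is nonnegative.
  have e : lam * (N : ℂ) = J + (K : ℂ) := by linear_combination -hint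
  have ere := congrArg Complex.re e
  have eim := congrArg Complex.im e
  simp at ere eim
  have j1 := abs_le.1 ((Complex.abs_re_le_norm J).trans hJN)
  have j2 := abs_le.1 ((Complex.abs_im_le_norm J).trans hJN)
  refine ⟨abs_le.2 ⟨?_, ?_⟩, ?_⟩ <;> by_contra! hc <;> nlinarith

theorem norm_sin_le_exp (w : ℂ) : ‖Complex.sin w‖ ≤ Real.exp |w.im| := by
  rw [Complex.sin, norm_div, norm_mul, Complex.norm_I, mul_one, Complex.norm_two,
    div_le_iff₀ (by norm_num)]
  refine (norm_sub_le _ _).trans ?_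
  rw [Complex.norm_exp, Complex.norm_exp]
  have h1 : (-w * Complex.I).re ≤ |w.im| := by simp [le_abs_self]
  have h2 : (w * Complex.I).re ≤ |w.im| := by simp [neg_le_abs]
  have := Real.exp_le_exp.2 h1
  have := Real.exp_le_exp.2 h2
  linarith

/-- The value at `1` of the solution of `v'' = (R - ω²) v`, `|R| ≤ 1`, to leading order. -/
theorem norm_mul_sub_sin_le (hRc : ContinuousOn R (Icc (-1) 1))
    (hR : ∀ s ∈ Icc (-1 : ℝ) 1, ‖R s‖ ≤ 1) (hv : ∀ s ∈ Icc (-1 : ℝ) 1, HasDerivAt v (v' s) s)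
    (hv' : ∀ s ∈ Icc (-1 : ℝ) 1, HasDerivAt v' ((R s - ω ^ 2) * v s) s)
    (h0 : v (-1) = 0) (h0' : v' (-1) = 1) (hω : |ω.im| ≤ 1) (hbig : 4 * Real.exp 2 ≤ ‖ω‖) :
    ‖ω * v 1 - Complex.sin (2 * ω)‖ ≤ 4 * Real.exp 2 ^ 2 / ‖ω‖ := by
  have hvc : ContinuousOn v (Icc (-1) 1) := fun s hs => (hv s hs).continuousAt.continuousWithinAt
  have hωpos : 0 < ‖ω‖ := lt_of_lt_of_le (by positivity) hbig
  have hsin : ∀ d ∈ Icc (0 : ℝ) 2, ‖Complex.sin (ω * d)‖ ≤ Real.exp 2 := fun d hd => by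
    refine (norm_sin_le_exp _).trans (Real.exp_le_exp.2 ?_)
    rw [Complex.im_mul_ofReal, abs_mul, abs_of_nonneg hd.1]
    nlinarith [hd.1, hd.2, abs_nonneg ω.im]
  obtain ⟨s₀, hs₀, hmax⟩ := isCompact_Icc.exists_isMaxOn (nonempty_Icc.2 (by norm_num)) hvc.norm
  set M := ‖v s₀‖ with hM
  have hvM : ∀ s ∈ Icc (-1 : ℝ) 1, ‖v s‖ ≤ M := fun s hs => hmax hs
  have hvol : ∀ x ∈ Icc (-1 : ℝ) 1,
      ‖ω * v x - Complex.sin (ω * ((x + 1 : ℝ) : ℂ))‖ ≤ 2 * Real.exp 2 * M := by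
    intro x hx
    have hsub : uIcc (-1 : ℝ) x ⊆ Icc (-1) 1 := by
      rw [uIcc_of_le hx.1]; exact Icc_subset_Icc_right hx.2
    -- Variation of constants: this function equals `ω v(x)` at `t = x` and `sin (ω (x + 1))` at `t
    -- = -1`, and its derivative contains only the perturbation `R`.
    have hd : ∀ t ∈ uIcc (-1 : ℝ) x, HasDerivAt
        (fun t : ℝ => ω * v t * Complex.cos (ω * (x - t)) + v' t * Complex.sin (ω * (x - t)))
        (R t * v t * Complex.sin (ω * (x - t))) t := fun t ht => by
      have dl : HasDerivAt (fun t : ℂ => ω * ((x : ℂ) - t)) (-ω) t := by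
        simpa using ((hasDerivAt_id (t : ℂ)).const_sub (x : ℂ)).const_mul ω
      refine ((((hv t (hsub ht)).const_mul ω).mul dl.ccos.comp_ofReal).add
        ((hv' t (hsub ht)).mul dl.csin.comp_ofReal)).congr_deriv ?_
      ring
    have hcont : ContinuousOn (fun t : ℝ => R t * v t * Complex.sin (ω * (x - t))) (uIcc (-1) x) :=
      ((hRc.mul hvc).mono hsub).mul (by fun_prop)
    have hint := intervalIntegral.integral_eq_sub_of_hasDerivAt hd hcont.intervalIntegrable
    rw [h0, h0'] at hint
    simp only [sub_self, mul_zero, Complex.cos_zero, Complex.sin_zero, mul_one, add_zero, zero_mul,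
      one_mul, zero_add] at hint
    rw [show ((x + 1 : ℝ) : ℂ) = (x : ℂ) - ((-1 : ℝ) : ℂ) by push_cast; ring, ← hint]
    have := intervalIntegral.norm_integral_le_of_norm_le_const (a := -1) (b := x)
      (f := fun t : ℝ => R t * v t * Complex.sin (ω * (x - t))) (C := M * Real.exp 2) fun t ht => by
        have ht' := hsub (uIoc_subset_uIcc ht)
        have hs := hsin (x - t) (by
          rw [uIoc_of_le hx.1] at ht
          exact ⟨by linarith [ht.2], by linarith [ht.1, hx.2]⟩)
        push_cast at hs
        rw [norm_mul, norm_mul]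
        have : ‖R t‖ * ‖v t‖ ≤ M :=
          (mul_le_of_le_one_left (norm_nonneg _) (hR t ht')).trans (hvM t ht')
        gcongr
    refine this.trans ?_
    have hxa : |x - -1| ≤ 2 := abs_le.2 ⟨by linarith [hx.1], by linarith [hx.2]⟩
    have hM0 : 0 ≤ M * Real.exp 2 := by positivity
    nlinarith
  -- At the maximum point, `‖ω‖ M ≤ e² + 2e² M`; as `‖ω‖ ≥ 4e²` the last term is absorbed. The
  -- constant `e²` bounds the sine for `|Im ω| ≤ 1` over an interval of length 2.
  have hM2 : M ≤ 2 * Real.exp 2 / ‖ω‖ := by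
    have h1 := hvol s₀ hs₀
    have h2 := hsin (s₀ + 1) ⟨by linarith [hs₀.1], by linarith [hs₀.2]⟩
    have h3 := norm_sub_norm_le (ω * v s₀) (Complex.sin (ω * ((s₀ + 1 : ℝ) : ℂ)))
    rw [norm_mul, ← hM] at h3
    rw [le_div_iff₀ hωpos]
    have h4 : 4 * Real.exp 2 * M ≤ ‖ω‖ * M := by gcongr
    linarith
  have h1 := hvol 1 (by norm_num)
  rw [show ω * ((1 + 1 : ℝ) : ℂ) = 2 * ω by push_cast; ring] at h1
  refine h1.trans ?_
  calc 2 * Real.exp 2 * M ≤ 2 * Real.exp 2 * (2 * Real.exp 2 / ‖ω‖) := by gcongr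
    _ = _ := by ring

end NormalForm

/-! ### Localisation and construction of eigenvalues -/

/-- A holomorphic function that is smaller at the centre of a disc than on its boundary has a
zero in the disc. -/
theorem exists_zero_of_norm_lt {f : ℂ → ℂ} (hf : Differentiable ℂ f) {z₀ : ℂ} {r m : ℝ}
    (hr : 0 < r) (h0 : ‖f z₀‖ < m) (hs : ∀ z ∈ Metric.sphere z₀ r, m ≤ ‖f z‖) :
    ∃ z ∈ Metric.closedBall z₀ r, f z = 0 := by
  by_contra! hne
  have hm : 0 < m := (norm_nonneg _).trans_lt h0
  have hd : DiffContOnCl ℂ (fun z => (f z)⁻¹) (Metric.ball z₀ r) := by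
    refine DifferentiableOn.diffContOnCl fun z hz => ?_
    rw [closure_ball z₀ hr.ne'] at hz
    exact ((hf z).inv (hne z hz)).differentiableWithinAt
  have h := Complex.norm_le_of_forall_mem_frontier_norm_le Metric.isBounded_ball hd (C := m⁻¹)
    (fun z hz => by
      rw [frontier_ball z₀ hr.ne'] at hz
      rw [norm_inv]
      exact inv_anti₀ hm (hs z hz)) (subset_closure (Metric.mem_ball_self hr))
  rw [norm_inv] at h
  have hpos : 0 < ‖f z₀‖ := norm_pos_iff.2 (hne z₀ (Metric.mem_closedBall_self hr.le))
  exact absurd ((inv_le_inv₀ hpos hm).1 h) (not_le.2 h0)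

theorem half_norm_le_norm_sin {d : ℂ} (hd : ‖d‖ ≤ 1 / 2) : ‖d‖ / 2 ≤ ‖Complex.sin d‖ := by
  have hI : ‖d * Complex.I‖ = ‖d‖ := by simp
  have h1 := Complex.norm_exp_sub_one_sub_id_le (x := d * Complex.I) (by rw [hI]; linarith)
  have h2 := Complex.norm_exp_sub_one_sub_id_le (x := -d * Complex.I) (by
    rw [neg_mul, norm_neg, hI]; linarith)
  rw [neg_mul, norm_neg, hI, ← neg_mul] at h2
  rw [hI] at h1
  have e : 2 * (Complex.sin d - d) = ((Complex.exp (-d * Complex.I) - 1 - -d * Complex.I) -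
      (Complex.exp (d * Complex.I) - 1 - d * Complex.I)) * Complex.I := by
    rw [Complex.sin]
    linear_combination (-2 * d) * Complex.I_sq
  have h3 : ‖2 * (Complex.sin d - d)‖ ≤ 2 * ‖d‖ ^ 2 := by
    rw [e, norm_mul, Complex.norm_I, mul_one]
    exact (norm_sub_le _ _).trans (by linarith)
  rw [norm_mul, Complex.norm_two] at h3
  have h4 := norm_sub_norm_le d (d - Complex.sin d)
  rw [sub_sub_cancel, norm_sub_rev] at h4
  nlinarith [norm_nonneg d]

theorem norm_sin_nat_mul_pi_add (k : ℕ) (d : ℂ) :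
    ‖Complex.sin (k * Real.pi + d)‖ = ‖Complex.sin d‖ := by
  induction k with
  | zero => simp
  | succ k ih =>
    rw [← ih, show ((k + 1 : ℕ) : ℂ) * Real.pi + d = k * Real.pi + d + Real.pi by push_cast; ring,
      Complex.sin_add_pi, norm_neg]

theorem differentiable_charFun (h : ℝ) : Differentiable ℂ (charFun h) := by
  have h1 := differentiable_leftSol_param (quadCoeff h) 1
  have h2 : Differentiable ℂ (constCoeff h) := by unfold constCoeff; fun_prop
  exact h1.comp h2

/-- `charFun` to leading order. -/
theorem exists_charFun_approx {h : ℝ} (hh : h ≠ 0) {E ω : ℂ} (hE : 100 ≤ ‖E‖)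
    (hω : phaseSq E / (h : ℂ) ^ 2 = ω ^ 2) (him : |ω.im| ≤ 1) (hbig : 4 * Real.exp 2 ≤ ‖ω‖) :
    ∃ b : ℂ, 1 / 2 ≤ ‖b‖ ∧ ‖b‖ ≤ 2 ∧
      ‖ω * (b * charFun h E) - Complex.sin (2 * ω)‖ ≤ 4 * Real.exp 2 ^ 2 / ‖ω‖ := by
  obtain ⟨b, R, v, v', hb1, hb2, hRc, hR, hv, hv', v0, v0', v1⟩ := exists_normal_form hh hE
  rw [hω] at hv'
  refine ⟨b, hb1, hb2, ?_⟩
  rw [← v1]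
  exact norm_mul_sub_sin_le hRc hR hv hv' v0 v0' him hbig

/-- A zero of `charFun` makes the normal form solution a Dirichlet eigenfunction with eigenvalue
`phaseSq E / h²`; its bounded distance from the half line becomes `h²` after rescaling. -/
theorem phaseSq_near_of_charFun_eq_zero {h : ℝ} (hh : h ≠ 0) {E : ℂ} (hE : 100 ≤ ‖E‖)
    (hD : charFun h E = 0) : |(phaseSq E).im| ≤ h ^ 2 ∧ -h ^ 2 ≤ (phaseSq E).re := by
  obtain ⟨b, R, v, v', -, -, hRc, hR, hv, hv', v0, v0', v1⟩ := exists_normal_form hh hE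
  rw [hD, mul_zero] at v1
  obtain ⟨h1, h2⟩ := eigenvalue_near_halfline hRc hR hv hv' v0 v0' v1
  have hpos : 0 < h ^ 2 := by positivity
  rw [← Complex.ofReal_pow] at h1 h2
  rw [Complex.div_ofReal_im, abs_div, abs_of_pos hpos, div_le_one hpos] at h1
  rw [Complex.div_ofReal_re, le_div_iff₀ hpos] at h2
  exact ⟨h1, by linarith⟩

/-- The choice `h = √c / ω₀` gives `phaseSq E₀ / h² = ω₀²` with `sin (2ω₀) = 0`, so `charFun` is
`O(ω₀⁻²)` at `E₀`. On the circle of radius `c / (8ω₀)` the frequency moves by between 1/32 and 5/32,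
which keeps the sine away from 0 and `charFun` of order at least `1/ω₀`. The threshold `1 / (256
ω₀)` separates the two, and `exists_zero_of_norm_lt` applies. -/
theorem exists_zero_charFun_near {E₀ : ℂ} (hE₀ : 101 ≤ ‖E₀‖) {c ω₀ : ℝ} (hc : 0 < c)
    (hF : phaseSq E₀ = c) {k : ℕ} (hk : 2 * ω₀ = k * Real.pi)
    (hbig : 4096 * Real.exp 2 ^ 2 + c ≤ ω₀) :
    ∃ E, ‖E - E₀‖ ≤ c / (8 * ω₀) ∧ charFun (√c / ω₀) E = 0 := by
  have he : 1 ≤ Real.exp 2 := Real.one_le_exp (by norm_num)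
  have he2 : Real.exp 2 ≤ Real.exp 2 ^ 2 := by nlinarith
  have hω₀ : 0 < ω₀ := by linarith
  have hsc : 0 < √c := Real.sqrt_pos.2 hc
  set h : ℝ := √c / ω₀ with hh
  have hhpos : 0 < h := by positivity
  have hh2 : h ^ 2 = c / ω₀ ^ 2 := by rw [hh, div_pow, Real.sq_sqrt hc.le]
  set r : ℝ := c / (8 * ω₀) with hr
  have hrpos : 0 < r := by positivity
  have hr1 : r ≤ 1 := by rw [hr, div_le_one (by positivity)]; linarith
  set C : ℝ := 4 * Real.exp 2 ^ 2 with hC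
  have hcC : (c : ℂ) ≠ 0 := by exact_mod_cast hc.ne'
  have hωC : (ω₀ : ℂ) ≠ 0 := by exact_mod_cast hω₀.ne'
  have hscale : ∀ w : ℂ, w / (h : ℂ) ^ 2 = w * ω₀ ^ 2 / c := fun w => by
    rw [show (h : ℂ) ^ 2 = (c : ℂ) / (ω₀ : ℂ) ^ 2 by exact_mod_cast hh2]
    field_simp
  have hnω₀ : ‖(ω₀ : ℂ)‖ = ω₀ := by rw [Complex.norm_real, Real.norm_of_nonneg hω₀.le]
  have hcenter : ‖charFun h E₀‖ < 1 / (256 * ω₀) := by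
    obtain ⟨b, hb1, -, hb⟩ := exists_charFun_approx (E := E₀) (ω := ω₀) hhpos.ne' (by linarith)
      (by rw [hF, hscale]; field_simp) (by simp) (by rw [hnω₀]; linarith)
    have hs : Complex.sin (2 * (ω₀ : ℂ)) = 0 := by
      have := Complex.sin_nat_mul_pi k
      rwa [show (k : ℂ) * (Real.pi : ℂ) = 2 * (ω₀ : ℂ) by exact_mod_cast hk.symm] at this
    rw [hs, sub_zero, norm_mul, norm_mul, hnω₀] at hb
    have h1 : ω₀ * (1 / 2 * ‖charFun h E₀‖) ≤ ω₀ * (‖b‖ * ‖charFun h E₀‖) := by gcongr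
    have h2 : C / ω₀ < 1 / 512 := by rw [div_lt_iff₀ hω₀]; linarith
    rw [lt_div_iff₀ (by positivity)]
    linarith
  have hsphere : ∀ E ∈ Metric.sphere E₀ r, 1 / (256 * ω₀) ≤ ‖charFun h E‖ := by
    intro E hEs
    rw [mem_sphere_iff_norm] at hEs
    have hE : 100 ≤ ‖E‖ := by
      have := norm_sub_norm_le E₀ (E₀ - E)
      rw [sub_sub_cancel, norm_sub_rev, hEs] at this
      linarith
    have hdiff := norm_phaseSq_sub_sub_le hE (by linarith : 100 ≤ ‖E₀‖)
    rw [hF, hEs] at hdiff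
    have hδ1 : ‖phaseSq E - c‖ ≤ 5 / 4 * r := by
      have := norm_add_le (phaseSq E - c - (E - E₀)) (E - E₀)
      rw [sub_add_cancel, hEs] at this
      linarith
    have hδ2 : 3 / 4 * r ≤ ‖phaseSq E - c‖ := by
      have := norm_sub_norm_le (E - E₀) (E - E₀ - (phaseSq E - c))
      rw [sub_sub_cancel, hEs, norm_sub_rev (E - E₀)] at this
      linarith
    -- With `phaseSq E = c (1 - ε)` the frequency at `E` is `ω₀ √(1 - ε)`.
    set ε : ℂ := -((phaseSq E - c) / c) with hε
    have hεn : ‖ε‖ = ‖phaseSq E - c‖ / c := by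
      rw [hε, norm_neg, norm_div, Complex.norm_real, Real.norm_of_nonneg hc.le]
    have hε1 : ω₀ * ‖ε‖ ≤ 5 / 32 := by
      rw [hεn, ← mul_div_assoc, div_le_iff₀ hc]
      calc ω₀ * ‖phaseSq E - c‖ ≤ ω₀ * (5 / 4 * r) := by gcongr
        _ = 5 / 32 * c := by rw [hr]; field_simp; norm_num
    have hε2 : 3 / 32 ≤ ω₀ * ‖ε‖ := by
      rw [hεn, ← mul_div_assoc, le_div_iff₀ hc]
      calc 3 / 32 * c = ω₀ * (3 / 4 * r) := by rw [hr]; field_simp; norm_num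
        _ ≤ ω₀ * ‖phaseSq E - c‖ := by gcongr
    have hεs : ‖ε‖ ≤ 1 / 2 := by nlinarith [norm_nonneg ε]
    have hεl : ‖ε‖ < 1 := by linarith
    set σ := sqrtOneSub ε with hσ
    have hσ2 : σ ^ 2 = 1 - ε := sqrtOneSub_sq hεl
    have hσ1 := norm_sqrtOneSub_sub_one_le hεl
    have hup : ω₀ * ‖σ - 1‖ ≤ 5 / 32 := (mul_le_mul_of_nonneg_left hσ1 hω₀.le).trans hε1
    have hlow : 1 / 32 ≤ ω₀ * ‖σ - 1‖ := by
      have e1 : ‖ε‖ = ‖σ - 1‖ * ‖σ + 1‖ := by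
        rw [← norm_mul, ← norm_neg ε]; congr 1; linear_combination -hσ2
      have e2 : ‖σ + 1‖ ≤ 3 := by
        have := norm_add_le (σ - 1) 2
        rw [show σ - 1 + 2 = σ + 1 by ring, Complex.norm_two] at this
        linarith
      have e3 : ‖σ - 1‖ * ‖σ + 1‖ ≤ ‖σ - 1‖ * 3 := by gcongr
      have e4 : ω₀ * ‖ε‖ ≤ ω₀ * (‖σ - 1‖ * 3) := by rw [e1]; gcongr
      linarith
    have hnd : ‖(ω₀ : ℂ) * (σ - 1)‖ = ω₀ * ‖σ - 1‖ := by rw [norm_mul, hnω₀]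
    have hωsum : (ω₀ : ℂ) * σ = ω₀ + ω₀ * (σ - 1) := by ring
    have hωlow : ω₀ - 1 ≤ ‖(ω₀ : ℂ) * σ‖ := by
      have := norm_sub_norm_le (ω₀ : ℂ) (-(ω₀ * (σ - 1)))
      rw [norm_neg, hnω₀, sub_neg_eq_add, ← hωsum, hnd] at this
      linarith
    have hωup : ‖(ω₀ : ℂ) * σ‖ ≤ 2 * ω₀ := by
      have := norm_add_le (ω₀ : ℂ) (ω₀ * (σ - 1))
      rw [← hωsum, hnω₀, hnd] at this
      linarith
    have him : |((ω₀ : ℂ) * σ).im| ≤ 1 := by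
      have := Complex.abs_im_le_norm ((ω₀ : ℂ) * (σ - 1))
      rw [hωsum, Complex.add_im, Complex.ofReal_im, zero_add]
      linarith
    obtain ⟨b, -, hb2, hb⟩ := exists_charFun_approx (ω := ω₀ * σ) hhpos.ne' hE
      (by rw [hscale, mul_pow, hσ2, hε]; field_simp; ring) him (by linarith)
    have hωpos : 0 < ‖(ω₀ : ℂ) * σ‖ := by linarith
    have hsin : 1 / 32 ≤ ‖Complex.sin (2 * ((ω₀ : ℂ) * σ))‖ := by
      rw [show 2 * ((ω₀ : ℂ) * σ) = k * Real.pi + 2 * (ω₀ * (σ - 1)) by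
        rw [show (k : ℂ) * (Real.pi : ℂ) = 2 * (ω₀ : ℂ) by exact_mod_cast hk.symm]; ring,
        norm_sin_nat_mul_pi_add]
      have e : ‖2 * ((ω₀ : ℂ) * (σ - 1))‖ = 2 * (ω₀ * ‖σ - 1‖) := by
        rw [norm_mul, hnd, Complex.norm_two]
      have := half_norm_le_norm_sin (d := 2 * ((ω₀ : ℂ) * (σ - 1))) (by rw [e]; linarith)
      rw [e] at this
      linarith
    have hCω : C / ‖(ω₀ : ℂ) * σ‖ ≤ 1 / 64 := by rw [div_le_iff₀ hωpos]; linarith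
    have h3 := norm_sub_norm_le (Complex.sin (2 * ((ω₀ : ℂ) * σ))) (Complex.sin (2 * (ω₀ * σ)) -
      (ω₀ : ℂ) * σ * (b * charFun h E))
    rw [sub_sub_cancel, norm_sub_rev (Complex.sin _)] at h3
    have h4 : ‖(ω₀ : ℂ) * σ * (b * charFun h E)‖ ≤ 2 * ω₀ * (2 * ‖charFun h E‖) := by
      rw [norm_mul, norm_mul b]; gcongr
    rw [div_le_iff₀ (by positivity)]
    linarith
  obtain ⟨E, hE, hE0⟩ := exists_zero_of_norm_lt (differentiable_charFun h) hrpos hcenter hsphere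
  exact ⟨E, mem_closedBall_iff_norm.1 hE, hE0⟩

/-! ### The limit spectrum and the curve -/

theorem continuousAt_phaseSq {E₀ : ℂ} (hE₀ : 101 ≤ ‖E₀‖) : ContinuousAt phaseSq E₀ := by
  have hev : ∀ᶠ E in 𝓝 E₀, 100 ≤ ‖E‖ :=
    (continuous_norm.continuousAt (x := E₀)).eventually (le_mem_nhds (by linarith))
  rw [ContinuousAt, tendsto_iff_norm_sub_tendsto_zero]
  have h0 : Tendsto (fun E => 2 * ‖E - E₀‖) (𝓝 E₀) (𝓝 0) := by
    have : Continuous fun E : ℂ => 2 * ‖E - E₀‖ := by fun_prop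
    simpa using this.tendsto E₀
  refine squeeze_zero' (Eventually.of_forall fun E => norm_nonneg _) ?_ h0
  filter_upwards [hev] with E hE
  have h1 := norm_phaseSq_sub_sub_le hE (by linarith : 100 ≤ ‖E₀‖)
  have h2 := norm_add_le (phaseSq E - phaseSq E₀ - (E - E₀)) (E - E₀)
  rw [sub_add_cancel] at h2
  linarith [norm_nonneg (E - E₀)]

theorem mem_gamma_of_mem_limitSpectrum {E₀ : ℂ} (hE₀ : 101 ≤ ‖E₀‖) (h : E₀ ∈ limitSpectrum) :
    E₀ ∈ Gamma := by
  obtain ⟨h, E, hpos, hlim, hE, hElim⟩ := h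
  rw [mem_gamma_iff (by linarith)]
  have hev : ∀ᶠ j in atTop, |(phaseSq (E j)).im| ≤ h j ^ 2 ∧ -h j ^ 2 ≤ (phaseSq (E j)).re := by
    have : ∀ᶠ j in atTop, 100 ≤ ‖E j‖ := hElim.norm.eventually (le_mem_nhds (by linarith))
    filter_upwards [this] with j hj
    exact phaseSq_near_of_charFun_eq_zero (hpos j).ne' hj
      ((mem_pSpectrum_iff (hpos j).ne' _).1 (hE j))
  have hF : Tendsto (fun j => phaseSq (E j)) atTop (𝓝 (phaseSq E₀)) :=
    (continuousAt_phaseSq hE₀).tendsto.comp hElim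
  have him := ((Complex.continuous_im.tendsto _).comp hF)
  have hre := ((Complex.continuous_re.tendsto _).comp hF)
  have h2 : Tendsto (fun j => h j ^ 2) atTop (𝓝 0) := by simpa using hlim.pow 2
  have h2n : Tendsto (fun j => -h j ^ 2) atTop (𝓝 0) := by simpa using h2.neg
  exact ⟨abs_nonpos_iff.1 (le_of_tendsto_of_tendsto him.abs h2 (hev.mono fun j hj => hj.1)),
    le_of_tendsto_of_tendsto h2n hre (hev.mono fun j hj => hj.2)⟩

theorem mem_limitSpectrum_of_mem_gamma {E₀ : ℂ} (hE₀ : 101 ≤ ‖E₀‖) (h : E₀ ∈ Gamma) :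
    E₀ ∈ limitSpectrum := by
  have hE1 : 100 ≤ ‖E₀‖ := by linarith
  obtain ⟨him, hre⟩ := (mem_gamma_iff hE1).1 h
  set c := (phaseSq E₀).re with hcdef
  have hF : phaseSq E₀ = c := Complex.ext (by simp [hcdef]) (by simp [him])
  -- The value 0 is excluded because `phaseSq E₀` is close to `E₀ - i/3`, which is large.
  have hc : 0 < c := by
    refine lt_of_le_of_ne hre fun h0 => ?_
    have h1 := norm_phaseSq_sub_le hE1
    rw [hF, ← h0, Complex.ofReal_zero, zero_sub, norm_neg] at h1
    have h2 := norm_sub_norm_le E₀ (Complex.I / 3)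
    have h3 : ‖Complex.I / 3‖ ≤ 1 := by rw [norm_div, Complex.norm_I]; norm_num
    have h4 : 3 / ‖E₀‖ ≤ 1 := by rw [div_le_one (by linarith)]; linarith
    linarith
  obtain ⟨K, hK⟩ := exists_nat_ge (4096 * Real.exp 2 ^ 2 + c)
  -- Frequencies with `2ω` in `π ℕ`; the shift `K` makes even the first one exceed the threshold of
  -- `exists_zero_charFun_near`.
  let ω : ℕ → ℝ := fun j => ((j + K : ℕ) : ℝ) * Real.pi / 2
  have hωge : ∀ j, ((j + K : ℕ) : ℝ) ≤ ω j := fun j => by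
    have h2 : (2 : ℝ) ≤ Real.pi := Real.two_le_pi
    have h0 : (0 : ℝ) ≤ ((j + K : ℕ) : ℝ) := Nat.cast_nonneg _
    simp only [ω]
    nlinarith
  have hbig : ∀ j, 4096 * Real.exp 2 ^ 2 + c ≤ ω j := fun j => by
    refine (hK.trans ?_).trans (hωge j)
    exact_mod_cast Nat.le_add_left K j
  have hpos : ∀ j, 0 < ω j := fun j => lt_of_lt_of_le (by positivity) (hbig j)
  have hωlim : Tendsto ω atTop atTop :=
    tendsto_atTop_mono hωge (tendsto_natCast_atTop_atTop.comp (tendsto_add_atTop_nat K))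
  have hex : ∀ j, ∃ E, ‖E - E₀‖ ≤ c / (8 * ω j) ∧ charFun (√c / ω j) E = 0 := fun j =>
    exists_zero_charFun_near hE₀ hc hF (k := j + K) (by simp only [ω]; ring) (hbig j)
  choose E hE1 hE2 using hex
  have hsc : 0 < √c := Real.sqrt_pos.2 hc
  refine ⟨fun j => √c / ω j, E, fun j => div_pos hsc (hpos j), hωlim.const_div_atTop _, fun j => ?_, ?_⟩
  · exact (mem_pSpectrum_iff (div_pos hsc (hpos j)).ne' _).2 (hE2 j)
  · rw [tendsto_iff_norm_sub_tendsto_zero]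
    refine squeeze_zero (fun j => norm_nonneg _) hE1 ?_
    exact (hωlim.const_mul_atTop (by norm_num : (0 : ℝ) < 8)).const_div_atTop _

end LimitSpectrum

theorem theorem6p4 :
    (∃ R : ℝ, 0 < R ∧ ∀ E : ℂ, R ≤ ‖E‖ →
      (E ∈ LimitSpectrum.limitSpectrum ↔ E ∈ LimitSpectrum.Gamma)) ∧
    (∃ (A C R : ℝ) (b : ℝ → ℝ), 0 < A ∧ 0 < C ∧ 0 < R ∧
      ContinuousOn b (Set.Ici A) ∧
      (∀ a : ℝ, A ≤ a → ∀ y : ℝ,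
        ((a : ℂ) + (y : ℂ) * Complex.I ∈ LimitSpectrum.Gamma ↔ y = b a)) ∧
      (∀ a : ℝ, A ≤ a → |b a - 1 / 3| ≤ C / a) ∧
      (∀ E : ℂ, E ∈ LimitSpectrum.Gamma → R ≤ ‖E‖ → A ≤ E.re)) :=
  ⟨⟨101, by norm_num, fun _ hE => ⟨LimitSpectrum.mem_gamma_of_mem_limitSpectrum hE,
    LimitSpectrum.mem_limitSpectrum_of_mem_gamma hE⟩⟩, LimitSpectrum.exists_gamma_asymptotics⟩
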